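/- **Theorem 6 (CLT of the rank-based coefficient under independence).** Let $X,Y$ be independent real random variables, neither of them almost surely constant, and let $h:[0,1]^2\to[0,\infty)$ be continuous and symmetric with $h(x,x)=0$ for all $x\in[0,1]$ and $h(x,y)>0$ for all $x\neq y$ in $[0,1]$. Assume that $h$ is Lipschitz: there is $K_h\in(0,\infty)$ with $|h(y_1,z_1)-h(y_2,z_2)|\le K_h(|y_1-y_2|+|z_1-z_2|)$ for all $(y_1,z_1),(y_2,z_2)\in[0,1]^2$. Let $(X_1,Y_1),(X_2,Y_2),\dots$ be i.i.d. copies of $(X,Y)$. For each $n$ let $(X_{(1)},Y_{[1]}),\dots,(X_{(n)},Y_{[n]})$ be the first $n$ pairs reordered so that $X_{(1)}\le\dots\le X_{(n)}$, with ties among the $X_i$ broken uniformly at random (that is, conditionally on the first $n$ pairs, the ordering permutation is uniformly distributed on the set of all permutations that sort $X_1,\dots,X_n$). Put $R(y)=\sum_{j=1}^n \mathrm{I}(Y_j\le y)$, $$\widetilde\zeta_n^{(h)}=\frac1n\sum_{i=1}^{n-1}h\Big(\frac{R(Y_{[i]})}{n},\frac{R(Y_{[i+1]})}{n}\Big),\qquad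 \widetilde\chi_n^{(h)}=\frac1{n^2}\sum_{i=1}^n\sum_{j=1}^n h\Big(\frac{R(Y_i)}{n},\frac{R(Y_j)}{n}\Big),$$ and $\widetilde\xi_n^{(h)}=1-\widetilde\zeta_n^{(h)}/\widetilde\chi_n^{(h)}$ (with $\widetilde\xi_n^{(h)}=1$ if $\widetilde\chi_n^{(h)}=0$). Then, as $n\to\infty$, $\sqrt n\,\widetilde\xi_n^{(h)}$ converges in distribution to $N(0,\widetilde\sigma^2)$, where, with $F_Y$ the c.d.f. of $Y$ and $Y_1,Y_2,Y_3$ i.i.d. copies of $Y$, $$\widetilde\sigma^2=\frac{\mathbb E\,h(F_Y(Y_1),F_Y(Y_2))^2-2\,\mathbb E\big(h(F_Y(Y_1),F_Y(Y_2))\,h(F_Y(Y_1),F_Y(Y_3))\big)+\big(\mathbb E\,h(F_Y(Y_1),F_Y(Y_2))\big)^2}{\big(\mathbb E\,h(F_Y(Y_1),F_Y(Y_2))\big)^2}$$ is strictly positive. -/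

import Mathlib

open MeasureTheory ProbabilityTheory Filter Topology

noncomputable section

namespace RankCorr

/-- The regularity condition on a kernel `h : [0,1]² → [0,∞)`: continuous, non-negative, symmetric,
zero on the diagonal, positive off the diagonal. The kernel is represented by a function
on `ℝ × ℝ` of which only the values on `[0,1]²` are ever constrained or used. -/
structure RegularKernel (h : ℝ → ℝ → ℝ) : Prop where
  continuousOn : ContinuousOn (fun p : ℝ × ℝ => h p.1 p.2) (Set.Icc 0 1 ×ˢ Set.Icc 0 1)
  nonneg : ∀ x ∈ Set.Icc (0 : ℝ) 1, ∀ y ∈ Set.Icc (0 : ℝ) 1, 0 ≤ h x y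
  symm : ∀ x ∈ Set.Icc (0 : ℝ) 1, ∀ y ∈ Set.Icc (0 : ℝ) 1, h x y = h y x
  diag : ∀ x ∈ Set.Icc (0 : ℝ) 1, h x x = 0
  pos : ∀ x ∈ Set.Icc (0 : ℝ) 1, ∀ y ∈ Set.Icc (0 : ℝ) 1, x ≠ y → 0 < h x y

/-- Lipschitz continuity of the kernel on `[0,1]²` for the `ℓ¹` distance. -/
def LipschitzKernel (h : ℝ → ℝ → ℝ) : Prop :=
  ∃ K : ℝ, 0 < K ∧
    ∀ y₁ ∈ Set.Icc (0 : ℝ) 1, ∀ z₁ ∈ Set.Icc (0 : ℝ) 1,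
    ∀ y₂ ∈ Set.Icc (0 : ℝ) 1, ∀ z₂ ∈ Set.Icc (0 : ℝ) 1,
      |h y₁ z₁ - h y₂ z₂| ≤ K * (|y₁ - y₂| + |z₁ - z₂|)

/-- The rank `R(t) = ∑ⱼ I(yⱼ ≤ t)` of `t` among the sample `y`. -/
def rank {n : ℕ} (y : Fin n → ℝ) (t : ℝ) : ℝ :=
  ∑ j : Fin n, if y j ≤ t then 1 else 0

/-- The variation statistic of the sample `y` listed in the order `y (τ 0), y (τ 1), …`. -/
def variationStat (h : ℝ → ℝ → ℝ) {n : ℕ} (y : Fin n → ℝ) (τ : Equiv.Perm (Fin n)) : ℝ :=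
  (1 / (n : ℝ)) * ∑ i : Fin (n - 1),
    h (rank y (y (τ ⟨i, by omega⟩)) / n) (rank y (y (τ ⟨i + 1, by omega⟩)) / n)

/-- The normalization statistic of the sample `y`. -/
def normalizationStat (h : ℝ → ℝ → ℝ) {n : ℕ} (y : Fin n → ℝ) : ℝ :=
  (1 / (n : ℝ) ^ 2) * ∑ i : Fin n, ∑ j : Fin n, h (rank y (y i) / n) (rank y (y j) / n)

open Classical in
/-- The rank-based correlation coefficient of the sample `y` listed in the order given by `τ`
(a permutation sorting the `x`-sample). -/
def rankCoeff (h : ℝ → ℝ → ℝ) {n : ℕ} (y : Fin n → ℝ) (τ : Equiv.Perm (Fin n)) : ℝ :=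
  if normalizationStat h y = 0 then 1
  else 1 - variationStat h y τ / normalizationStat h y

open Classical in
/-- The permutations `σ` that sort the sample `x`, i.e. `x (σ 0) ≤ x (σ 1) ≤ …`. -/
def sortingPerms {n : ℕ} (x : Fin n → ℝ) : Finset (Equiv.Perm (Fin n)) :=
  Finset.univ.filter fun σ => Monotone fun i => x (σ i)

open Classical in
/-- `τ` is a random ordering of the sample `(x₀, y₀), …, (xₙ₋₁, yₙ₋₁)` by increasing `x`, with ties
among the `x`'s broken uniformly at random: conditionally on the whole sample, `τ` is
uniformly distributed on the set of the permutations that sort `x`. -/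
structure IsUniformOrdering {Ω : Type*} [MeasurableSpace Ω] (μ : Measure Ω) {n : ℕ}
    (x y : Fin n → Ω → ℝ) (τ : Ω → Equiv.Perm (Fin n)) : Prop where
  measurable : ∀ σ : Equiv.Perm (Fin n), MeasurableSet {ω | τ ω = σ}
  sorted : ∀ᵐ ω ∂μ, τ ω ∈ sortingPerms fun i => x i ω
  uniform : ∀ σ : Equiv.Perm (Fin n),
    μ⟦{ω | τ ω = σ} | MeasurableSpace.comap (fun ω (i : Fin n) => (x i ω, y i ω)) inferInstance⟧
      =ᵐ[μ] fun ω => if σ ∈ sortingPerms (fun i => x i ω)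
        then 1 / ((sortingPerms fun i => x i ω).card : ℝ) else 0

/-- The asymptotic variance `σ²` for a kernel `h`, a function `F` and the law `ν` of `Y`;
`ν.prod ν` and `ν.prod (ν.prod ν)` are the joint laws of two and of three i.i.d. copies of `Y`. -/
def asympVar (h : ℝ → ℝ → ℝ) (F : ℝ → ℝ) (ν : Measure ℝ) : ℝ :=
  ((∫ p : ℝ × ℝ, h (F p.1) (F p.2) ^ 2 ∂(ν.prod ν))
    - 2 * (∫ p : ℝ × ℝ × ℝ, h (F p.1) (F p.2.1) * h (F p.1) (F p.2.2) ∂(ν.prod (ν.prod ν)))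
    + (∫ p : ℝ × ℝ, h (F p.1) (F p.2) ∂(ν.prod ν)) ^ 2)
  / (∫ p : ℝ × ℝ, h (F p.1) (F p.2) ∂(ν.prod ν)) ^ 2

end RankCorr

end

/-! ### Resampling and permuting coordinates of an i.i.d. sequence; second-moment tools. -/

noncomputable section

namespace RankCorr

/-! Given the sample, the law of the ordering by X is a function of the X's alone, so independence
of X and Y makes the ordering independent of the Y's. I.i.d. vectors are exchangeable; hence for
each n the coefficient has the law of the same statistic computed along Y₁, …, Yₙ in their natural
order (`map_reordered_eq`). What remains is a limit theorem on the product space of the law ν of Y.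

There √n ξ = -(W/√n)/χ when χ ≠ 0, where W = n(ζ - χ) is the `contrast` of the array h(Fₙ(Yᵢ),
Fₙ(Yⱼ)): its sum along the path 1, 2, …, n minus 1/n times its full double sum. With g(u) = ∫
h(F(u), F(v)) dν(v) and θ = ∫ g dν, the array splits (`rankKernel_eq`) into the error of replacing F
by Fₙ, the additive part g(Yᵢ) + g(Yⱼ) - θ, and the degenerate part ψ(Yᵢ, Yⱼ) of the Hoeffding
decomposition.

The error has entries of order n^(-1/2), so a termwise bound on its contrast gives only √n, which is
not negligible. But the array is exchangeable, and swapping two observations makes most covariances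
of the contrast vanish: the second moment is of order n times that of one entry
(`integral_sq_contrast_le`), that is, O(1). The contrast of the additive part is a boundary term
(`contrast_additive`), and 1/n times the double sum of ψ is O(1) in mean square. So W/√n is
asymptotically n^(-1/2) Σ ψ(Yᵢ, Yᵢ₊₁), a normalized sum of bounded martingale differences. McLeish's
product method gives its normal limit with variance s² = ∫∫ ψ²
(`DegenerateKernel.tendstoInDistribution`), and since χ → θ in probability, Slutsky's lemma gives
the variance s²/θ², which expands into the stated formula.

If θ were 0, F(Y) would be a.s. constant, and so would Y (`kernelMean_pos`). If s² were 0, h would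
be additive a.e. in terms of F; by continuity this persists on the diagonal, where h = 0, so g = θ/2
a.e. and θ = θ/2 (`kernelVar_pos`). -/

/-- The law of an i.i.d. sequence with marginal `ν`. -/
abbrev iidLaw (ν : Measure ℝ) : Measure (ℕ → ℝ) := Measure.infinitePi fun _ : ℕ => ν

variable {ν : Measure ℝ} [IsProbabilityMeasure ν]

lemma measurable_update_prod (j : ℕ) :
    Measurable fun p : (ℕ → ℝ) × ℝ => Function.update p.1 j p.2 := by
  refine measurable_pi_lambda _ fun i => ?_
  by_cases h : i = j
  · subst h; simpa using measurable_snd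
  · simp only [Function.update_of_ne h]; fun_prop

/-- Resampling one coordinate preserves the law of an i.i.d. sequence. -/
lemma measurePreserving_update (j : ℕ) :
    MeasurePreserving (fun p : (ℕ → ℝ) × ℝ => Function.update p.1 j p.2)
      ((iidLaw ν).prod ν) (iidLaw ν) := by
  refine ⟨measurable_update_prod j, Measure.eq_infinitePi _ fun s t ht => ?_⟩
  rw [Measure.map_apply (measurable_update_prod j)
    (MeasurableSet.pi s.countable_toSet fun i _ => ht i)]
  -- If `j ∈ s`, the constraint on coordinate `j` falls on the fresh value and the discarded one
  -- becomes free.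
  by_cases hj : j ∈ s
  · have : (fun p : (ℕ → ℝ) × ℝ => Function.update p.1 j p.2) ⁻¹' Set.pi s t
        = Set.pi (s.erase j) t ×ˢ t j := by
      ext p
      simp only [Set.mem_preimage, Set.mem_pi, Finset.mem_coe, Set.mem_prod, Finset.mem_erase]
      constructor
      · intro h
        refine ⟨fun i hi => ?_, by simpa using h j hj⟩
        simpa [Function.update_of_ne hi.1] using h i hi.2
      · rintro ⟨h1, h2⟩ i hi
        by_cases h : i = j
        · subst h; simpa using h2
        · simpa [Function.update_of_ne h] using h1 i ⟨h, hi⟩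
    rw [this, Measure.prod_prod, Measure.infinitePi_pi _ fun i _ => ht i,
      Finset.prod_erase_mul _ _ hj]
  · have : (fun p : (ℕ → ℝ) × ℝ => Function.update p.1 j p.2) ⁻¹' Set.pi s t
        = Set.pi s t ×ˢ Set.univ := by
      ext p
      simp only [Set.mem_preimage, Set.mem_pi, Finset.mem_coe, Set.mem_prod, Set.mem_univ,
        and_true]
      refine forall₂_congr fun i hi => ?_
      rw [Function.update_of_ne (by rintro rfl; exact hj hi)]
    rw [this, Measure.prod_prod, Measure.infinitePi_pi _ fun i _ => ht i, measure_univ, mul_one]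

/-- Integrating out the coordinate `j` of an i.i.d. sequence. -/
lemma integral_iidLaw_update {E : Type*} [NormedAddCommGroup E] [NormedSpace ℝ E]
    {g : (ℕ → ℝ) → E} (hg : Integrable g (iidLaw ν)) (j : ℕ) :
    ∫ y, g y ∂iidLaw ν = ∫ y, ∫ t, g (Function.update y j t) ∂ν ∂iidLaw ν := by
  have hmp := measurePreserving_update (ν := ν) j
  have hint : Integrable (fun p : (ℕ → ℝ) × ℝ => g (Function.update p.1 j p.2))
      ((iidLaw ν).prod ν) := hmp.integrable_comp_of_integrable hg
  rw [← integral_prod _ hint]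
  conv_lhs => rw [← hmp.map_eq]
  rw [integral_map hmp.measurable.aemeasurable]
  rw [hmp.map_eq]
  exact hg.aestronglyMeasurable

/-- Stands in for conditional expectation: every orthogonality relation below comes from a
coordinate `j` whose integration alone already gives zero. -/
lemma integral_iidLaw_eq_zero {E : Type*} [NormedAddCommGroup E] [NormedSpace ℝ E]
    {g : (ℕ → ℝ) → E} (hg : Integrable g (iidLaw ν)) (j : ℕ)
    (h : ∀ y, ∫ t, g (Function.update y j t) ∂ν = 0) :
    ∫ y, g y ∂iidLaw ν = 0 := by
  rw [integral_iidLaw_update hg j]; simp [h]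

/-- An i.i.d. sequence is exchangeable. -/
lemma measurePreserving_comp_perm (σ : Equiv.Perm ℕ) :
    MeasurePreserving (fun y : ℕ → ℝ => fun i => y (σ i)) (iidLaw ν) (iidLaw ν) := by
  refine ⟨by fun_prop, ?_⟩
  exact Measure.map_infinitePi_infinitePi_of_inj (P := fun _ : ℕ => ν) σ.injective

lemma integral_comp_perm (σ : Equiv.Perm ℕ) {g : (ℕ → ℝ) → ℝ} (hg : Measurable g) :
    ∫ y, g (fun i => y (σ i)) ∂iidLaw ν = ∫ y, g y ∂iidLaw ν := by
  have hmp := measurePreserving_comp_perm (ν := ν) σ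
  conv_rhs => rw [← hmp.map_eq]
  rw [integral_map hmp.measurable.aemeasurable]
  exact hg.aestronglyMeasurable

section Moments

variable {S : Type*} [MeasurableSpace S] {P : Measure S} [IsProbabilityMeasure P]

lemma integrable_of_abs_le {g : S → ℝ} (hg : Measurable g) {C : ℝ} (hC : ∀ y, |g y| ≤ C) :
    Integrable g P :=
  Integrable.of_bound hg.aestronglyMeasurable C (ae_of_all _ hC)

lemma abs_integral_le {g : S → ℝ} {C : ℝ} (hC : ∀ y, |g y| ≤ C) :
    |∫ y, g y ∂P| ≤ C := by
  have := norm_integral_le_of_norm_le_const (μ := P) (f := g) (ae_of_all _ hC)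
  simpa using this

/-- Second moment of a finite sum of bounded variables from bounds on the mixed moments. -/
lemma integral_sq_sum_le {ι : Type*} (s : Finset ι) {f : ι → S → ℝ}
    (hf : ∀ i ∈ s, Measurable (f i)) {C : ℝ} (hC : ∀ i ∈ s, ∀ y, |f i y| ≤ C) {c : ι → ι → ℝ}
    (hc : ∀ i ∈ s, ∀ j ∈ s, ∫ y, f i y * f j y ∂P ≤ c i j) :
    ∫ y, (∑ i ∈ s, f i y) ^ 2 ∂P ≤ ∑ i ∈ s, ∑ j ∈ s, c i j := by
  have hint : ∀ i ∈ s, ∀ j ∈ s, Integrable (fun y => f i y * f j y) P := fun i hi j hj =>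
    integrable_of_abs_le ((hf i hi).mul (hf j hj)) (C := C * C) fun y => by
      rw [abs_mul]
      exact mul_le_mul (hC i hi y) (hC j hj y) (abs_nonneg _) ((abs_nonneg _).trans (hC i hi y))
  simp_rw [sq, Finset.sum_mul_sum]
  rw [integral_finsetSum _ fun i hi => integrable_finsetSum _ fun j hj => hint i hi j hj]
  refine Finset.sum_le_sum fun i hi => ?_
  rw [integral_finsetSum _ fun j hj => hint i hi j hj]
  exact Finset.sum_le_sum fun j hj => hc i hi j hj

/-- Second moment of a sum of bounded orthogonal variables. -/
lemma integral_sq_sum_le_of_orthogonal {n : ℕ} {f : ℕ → S → ℝ}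
    (hf : ∀ i, Measurable (f i)) {C : ℝ} (hC : ∀ i y, |f i y| ≤ C)
    (h : ∀ i j, i < j → ∫ y, f i y * f j y ∂P = 0) :
    ∫ y, (∑ i ∈ Finset.range n, f i y) ^ 2 ∂P ≤ n * C ^ 2 := by
  refine (integral_sq_sum_le (c := fun i j => if i = j then C ^ 2 else 0) _ (fun i _ => hf i)
    (fun i _ => hC i) fun i _ j _ => ?_).trans ?_
  · split_ifs with hij
    · subst hij
      refine (le_abs_self _).trans (abs_integral_le fun y => ?_)
      rw [abs_mul, sq]
      exact mul_le_mul (hC i y) (hC i y) (abs_nonneg _) ((abs_nonneg _).trans (hC i y))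
    · rcases lt_or_gt_of_ne hij with h' | h'
      · exact (h i j h').le
      · simp_rw [mul_comm (f i _)]; exact (h j i h').le
  · simp +contextual [Finset.sum_ite_eq]

/-- Convergence in probability from convergence of second moments. -/
lemma tendstoInMeasure_of_integral_sq_le {Z : ℕ → S → ℝ} (hZ : ∀ n, Measurable (Z n))
    (hb : ∀ n, ∃ C, ∀ y, |Z n y| ≤ C) {c : ℕ → ℝ} (hc : Tendsto c atTop (𝓝 0))
    (h : ∀ᶠ n in atTop, ∫ y, Z n y ^ 2 ∂P ≤ c n) :
    TendstoInMeasure P Z atTop fun _ => 0 := by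
  rw [tendstoInMeasure_iff_measureReal_norm]
  intro ε hε
  have hlim : Tendsto (fun n => c n / ε ^ 2) atTop (𝓝 0) := by simpa using hc.div_const (ε ^ 2)
  refine tendsto_of_tendsto_of_tendsto_of_le_of_le' tendsto_const_nhds hlim
    (Eventually.of_forall fun n => measureReal_nonneg) ?_
  filter_upwards [h] with n hn
  rw [le_div_iff₀ (by positivity), mul_comm]
  obtain ⟨C, hC⟩ := hb n
  have hint : Integrable (fun y => Z n y ^ 2) P :=
    integrable_of_abs_le ((hZ n).pow_const 2) (C := C ^ 2) fun y => by
      rw [abs_pow]; exact pow_le_pow_left₀ (abs_nonneg _) (hC y) 2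
  refine le_trans (mul_le_mul_of_nonneg_left (measureReal_mono fun y hy => ?_) (sq_nonneg ε)) ((mul_meas_ge_le_integral_of_nonneg (ae_of_all _ fun y => sq_nonneg (Z n y))
    hint (ε ^ 2)).trans hn)
  simp only [sub_zero, Real.norm_eq_abs, Set.mem_ofPred_eq] at hy ⊢
  rw [← sq_abs (Z n y)]
  exact pow_le_pow_left₀ hε.le hy 2

end Moments

end RankCorr

end

/-! ### Second moment of the contrast of an exchangeable array. -/

noncomputable section

namespace RankCorr

variable {ν : Measure ℝ} [IsProbabilityMeasure ν]

lemma sum_ite_le_one {s : Finset ℕ} {p : ℕ → Prop} [DecidablePred p]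
    (hp : ∀ x y, p x → p y → x = y) : ∑ x ∈ s, (if p x then (1 : ℝ) else 0) ≤ 1 := by
  rw [Finset.sum_boole]
  exact_mod_cast Finset.card_le_one.2 fun a ha b hb =>
    hp a b (Finset.mem_filter.1 ha).2 (Finset.mem_filter.1 hb).2

/-- The sum of an array along the path `0, 1, …, n - 1`, centred by its mean over all orders. -/
def contrast (n : ℕ) (a : ℕ → ℕ → ℝ) : ℝ :=
  ∑ i ∈ Finset.range (n - 1), a i (i + 1)
    - (1 / (n : ℝ)) * ∑ i ∈ Finset.range n, ∑ j ∈ Finset.range n, a i j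

lemma contrast_add (n : ℕ) (a b : ℕ → ℕ → ℝ) :
    contrast n (fun i j => a i j + b i j) = contrast n a + contrast n b := by
  simp only [contrast, Finset.sum_add_distrib]; ring

/-- Averaging each path term over a dummy index `j` produces differences that change sign when the
observations `i + 1` and `j` are exchanged. The last row has no successor on the path and stays as a
boundary term. -/
lemma contrast_eq {n : ℕ} (hn : 0 < n) (a : ℕ → ℕ → ℝ) :
    contrast n a = (1 / (n : ℝ)) * ∑ p ∈ Finset.range (n - 1) ×ˢ Finset.range n,
        (a p.1 (p.1 + 1) - a p.1 p.2)
      - (1 / (n : ℝ)) * ∑ j ∈ Finset.range n, a (n - 1) j := by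
  obtain ⟨m, rfl⟩ : ∃ m, n = m + 1 := ⟨n - 1, by omega⟩
  have h0 : ((m + 1 : ℕ) : ℝ) ≠ 0 := by positivity
  rw [Finset.sum_product]
  simp only [contrast, Nat.add_sub_cancel, Finset.sum_sub_distrib, Finset.sum_const,
    Finset.card_range, nsmul_eq_mul]
  rw [Finset.sum_range_succ (fun i => ∑ j ∈ Finset.range (m + 1), a i j) m, ← Finset.mul_sum]
  field_simp
  ring

/-- Each of the seven equations removes one degree of freedom from the quadruple of indices, leaving
at most n³ solutions. These are the quadruples on which the swap argument below fails. -/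
lemma sum_coincidences_le (n : ℕ) :
    ∑ p ∈ Finset.range (n - 1) ×ˢ Finset.range n, ∑ q ∈ Finset.range (n - 1) ×ˢ Finset.range n,
      ((if p.1 = p.2 then (1 : ℝ) else 0) + (if p.1 + 1 = q.1 then 1 else 0)
        + (if p.1 = q.1 then 1 else 0) + (if p.1 + 1 = q.2 then 1 else 0)
        + (if p.2 = q.1 then 1 else 0) + (if p.2 = q.1 + 1 then 1 else 0)
        + (if p.2 = q.2 then 1 else 0)) ≤ 7 * (n : ℝ) ^ 3 := by
  have hcard : ((n - 1 : ℕ) : ℝ) ≤ n := by exact_mod_cast Nat.sub_le n 1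
  have hn : (0 : ℝ) ≤ n := Nat.cast_nonneg n
  have key : ∀ i j : ℕ, ∑ q ∈ Finset.range (n - 1) ×ˢ Finset.range n,
      ((if i = j then (1 : ℝ) else 0) + (if i + 1 = q.1 then 1 else 0)
        + (if i = q.1 then 1 else 0) + (if i + 1 = q.2 then 1 else 0)
        + (if j = q.1 then 1 else 0) + (if j = q.1 + 1 then 1 else 0)
        + (if j = q.2 then 1 else 0)) ≤ (n : ℝ) ^ 2 * (if i = j then 1 else 0) + 6 * n := by
    intro i j
    have fst : ∀ c : ℕ → ℝ, ∑ i' ∈ Finset.range (n - 1), c i' ≤ 1 →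
        ∑ i' ∈ Finset.range (n - 1), ∑ _j' ∈ Finset.range n, c i' ≤ n := fun c hc => by
      simp only [Finset.sum_const, Finset.card_range, nsmul_eq_mul]
      rw [← Finset.mul_sum]; nlinarith
    have snd : ∀ c : ℕ → ℝ, ∑ i' ∈ Finset.range n, c i' ≤ 1 →
        ∑ _i' ∈ Finset.range (n - 1), ∑ j' ∈ Finset.range n, c j' ≤ n := fun c hc => by
      have : (0 : ℝ) ≤ ((n - 1 : ℕ) : ℝ) := Nat.cast_nonneg _
      simp only [Finset.sum_const, Finset.card_range, nsmul_eq_mul]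
      nlinarith
    rw [Finset.sum_product]
    simp only [Finset.sum_add_distrib]
    have h1 := fst (fun x => if i + 1 = x then 1 else 0) (sum_ite_le_one (by omega))
    have h2 := fst (fun x => if i = x then 1 else 0) (sum_ite_le_one (by omega))
    have h3 := fst (fun x => if j = x then 1 else 0) (sum_ite_le_one (by omega))
    have h4 := fst (fun x => if j = x + 1 then 1 else 0) (sum_ite_le_one (by omega))
    have h5 := snd (fun x => if i + 1 = x then 1 else 0) (sum_ite_le_one (by omega))
    have h6 := snd (fun x => if j = x then 1 else 0) (sum_ite_le_one (by omega))
    have h7 : ∑ _i' ∈ Finset.range (n - 1), ∑ _j' ∈ Finset.range n, (if i = j then (1 : ℝ) else 0)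
        ≤ (n : ℝ) ^ 2 * (if i = j then 1 else 0) := by
      simp only [Finset.sum_const, Finset.card_range, nsmul_eq_mul]
      have : (0 : ℝ) ≤ if i = j then (1 : ℝ) else 0 := by split_ifs <;> norm_num
      rw [sq, mul_assoc]; gcongr
    linarith
  refine (Finset.sum_le_sum fun p _ => key p.1 p.2).trans ?_
  rw [Finset.sum_product]
  have inner : ∀ i, ∑ j ∈ Finset.range n,
      ((n : ℝ) ^ 2 * (if i = j then (1 : ℝ) else 0) + 6 * (n : ℝ)) ≤ 7 * (n : ℝ) ^ 2 := fun i => by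
    have := sum_ite_le_one (s := Finset.range n) (p := fun x => i = x) (by omega)
    rw [Finset.sum_add_distrib, ← Finset.mul_sum]
    simp only [Finset.sum_const, Finset.card_range, nsmul_eq_mul]
    nlinarith [sq_nonneg (n : ℝ)]
  refine (Finset.sum_le_sum fun i _ => inner i).trans ?_
  simp only [Finset.sum_const, Finset.card_range, nsmul_eq_mul]
  nlinarith [sq_nonneg (n : ℝ)]

/-- The contrast of an exchangeable array has a second moment of order `n`. -/
lemma integral_sq_contrast_le {n : ℕ} (hn : 0 < n) {A : (ℕ → ℝ) → ℕ → ℕ → ℝ}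
    (hA : ∀ i j, Measurable fun y => A y i j) {M : ℝ} (hM : ∀ y i j, |A y i j| ≤ M)
    (hswap : ∀ p < n, ∀ q < n, ∀ y i j,
      A (fun l => y (Equiv.swap p q l)) i j = A y (Equiv.swap p q i) (Equiv.swap p q j))
    {a : ℝ} (ha : ∀ i < n, ∀ j < n, ∫ y, A y i j ^ 2 ∂iidLaw ν ≤ a) :
    ∫ y, contrast n (A y) ^ 2 ∂iidLaw ν ≤ 58 * n * a := by
  have hn' : (1 : ℝ) ≤ n := by exact_mod_cast hn
  have ha0 : 0 ≤ a := (integral_nonneg fun y => sq_nonneg _).trans (ha 0 hn 0 hn)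
  have hsq : ∀ i j, Integrable (fun y => A y i j ^ 2) (iidLaw ν) := fun i j =>
    integrable_of_abs_le ((hA i j).pow_const 2) (C := M ^ 2) fun y => by
      rw [abs_pow]; exact pow_le_pow_left₀ (abs_nonneg _) (hM y i j) 2
  set s := Finset.range (n - 1) ×ˢ Finset.range n
  set f : ℕ × ℕ → (ℕ → ℝ) → ℝ := fun p y => A y p.1 (p.1 + 1) - A y p.1 p.2
  have hf : ∀ p, Measurable (f p) := fun p => (hA _ _).sub (hA _ _)
  have hfb : ∀ p y, |f p y| ≤ 2 * M := fun p y =>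
    (abs_sub _ _).trans (by linarith [hM y p.1 (p.1 + 1), hM y p.1 p.2])
  have hff : ∀ p q, Integrable (fun y => f p y * f q y) (iidLaw ν) := fun p q =>
    integrable_of_abs_le ((hf p).mul (hf q)) (C := 2 * M * (2 * M)) fun y => by
      rw [abs_mul]
      exact mul_le_mul (hfb p y) (hfb q y) (abs_nonneg _) ((abs_nonneg _).trans (hfb p y))
  have hmix : ∀ p ∈ s, ∀ q ∈ s, ∫ y, f p y * f q y ∂iidLaw ν ≤ 4 * a *
      ((if p.1 = p.2 then (1 : ℝ) else 0) + (if p.1 + 1 = q.1 then 1 else 0)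
        + (if p.1 = q.1 then 1 else 0) + (if p.1 + 1 = q.2 then 1 else 0)
        + (if p.2 = q.1 then 1 else 0) + (if p.2 = q.1 + 1 then 1 else 0)
        + (if p.2 = q.2 then 1 else 0)) := by
    rintro ⟨i, j⟩ hp ⟨i', j'⟩ hq
    simp only [s, Finset.mem_product, Finset.mem_range] at hp hq
    by_cases hgood : i ≠ j ∧ i + 1 ≠ i' ∧ i ≠ i' ∧ i + 1 ≠ j' ∧ j ≠ i' ∧ j ≠ i' + 1 ∧ j ≠ j'
    · obtain ⟨h1, h2, h3, h4, h5, h6, h7⟩ := hgood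
      simp only [h1, h2, h3, h4, h5, h6, h7, if_false, add_zero, mul_zero]
      have hm : Measurable fun y => f (i, j) y * f (i', j') y := (hf _).mul (hf _)
      -- Swapping the observations `i + 1` and `j` preserves the law, negates the first difference
      -- and, as there is no coincidence, fixes the second; so the mixed moment equals its own
      -- opposite. If `j = i + 1` the first difference is zero anyway.
      have hex := integral_comp_perm (ν := ν) (Equiv.swap (i + 1) j) hm
      have hneg : ∀ y : ℕ → ℝ, f (i, j) (fun l => y (Equiv.swap (i + 1) j l))
          * f (i', j') (fun l => y (Equiv.swap (i + 1) j l)) = - (f (i, j) y * f (i', j') y) := by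
        intro y
        simp only [f]
        rw [hswap _ (by omega) _ hp.2, hswap _ (by omega) _ hp.2, hswap _ (by omega) _ hp.2,
          hswap _ (by omega) _ hp.2, Equiv.swap_apply_left, Equiv.swap_apply_right,
          Equiv.swap_apply_of_ne_of_ne (x := i) (by omega) h1,
          Equiv.swap_apply_of_ne_of_ne (x := i') (by omega) (Ne.symm h5),
          Equiv.swap_apply_of_ne_of_ne (x := i' + 1) (by omega) (Ne.symm h6),
          Equiv.swap_apply_of_ne_of_ne (x := j') (Ne.symm h4) (Ne.symm h7)]
        ring
      simp_rw [hneg, integral_neg] at hex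
      linarith
    -- On a coincidence the crude bound by second moments suffices, since such quadruples are rarer
    -- by a factor n.
    · have h4a : ∀ p : ℕ × ℕ, p.1 < n - 1 → p.2 < n → ∫ y, f p y ^ 2 ∂iidLaw ν ≤ 4 * a := by
        intro p h1 h2
        have hle : ∫ y, f p y ^ 2 ∂iidLaw ν
            ≤ ∫ y, (2 * A y p.1 (p.1 + 1) ^ 2 + 2 * A y p.1 p.2 ^ 2) ∂iidLaw ν := by
          refine integral_mono (by simpa only [sq] using hff p p)
            (((hsq _ _).const_mul 2).add ((hsq _ _).const_mul 2)) fun y => ?_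
          simp only [f]
          nlinarith [sq_nonneg (A y p.1 (p.1 + 1) + A y p.1 p.2)]
        rw [integral_add ((hsq _ _).const_mul 2) ((hsq _ _).const_mul 2), integral_const_mul,
          integral_const_mul] at hle
        linarith [ha p.1 (by omega) (p.1 + 1) (by omega), ha p.1 (by omega) p.2 h2]
      have hle : ∫ y, f (i, j) y * f (i', j') y ∂iidLaw ν
          ≤ ∫ y, (1 / 2 * f (i, j) y ^ 2 + 1 / 2 * f (i', j') y ^ 2) ∂iidLaw ν := by
        have hi : ∀ p, Integrable (fun y => 1 / 2 * f p y ^ 2) (iidLaw ν) := fun p =>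
          Integrable.const_mul (by simpa only [sq] using hff p p) _
        refine integral_mono (hff _ _) ((hi _).add (hi _)) fun y => ?_
        simp only
        nlinarith [sq_nonneg (f (i, j) y - f (i', j') y)]
      rw [integral_add (Integrable.const_mul (by simpa only [sq] using hff _ _) _)
        (Integrable.const_mul (by simpa only [sq] using hff _ _) _), integral_const_mul,
        integral_const_mul] at hle
      have hb : ∫ y, f (i, j) y * f (i', j') y ∂iidLaw ν ≤ 4 * a * 1 := by
        linarith [h4a (i, j) hp.1 hp.2, h4a (i', j') hq.1 hq.2]
      refine hb.trans (mul_le_mul_of_nonneg_left ?_ (by linarith))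
      have hnn : ∀ (p : Prop) [Decidable p], (0 : ℝ) ≤ if p then (1 : ℝ) else 0 := fun p _ => by
        split_ifs <;> norm_num
      have n1 := hnn (i = j)
      have n2 := hnn (i + 1 = i')
      have n3 := hnn (i = i')
      have n4 := hnn (i + 1 = j')
      have n5 := hnn (j = i')
      have n6 := hnn (j = i' + 1)
      have n7 := hnn (j = j')
      simp only [not_and_or, not_not] at hgood
      rcases hgood with h | h | h | h | h | h | h <;> rw [if_pos h] at * <;> linarith
  -- 28 is the 4 of the crude bound times the seven coincidence patterns.
  have hmain : ∫ y, (∑ p ∈ s, f p y) ^ 2 ∂iidLaw ν ≤ 28 * a * n ^ 3 := by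
    refine (integral_sq_sum_le s (fun p _ => hf p) (fun p _ => hfb p) hmix).trans ?_
    simp_rw [← Finset.mul_sum]
    nlinarith [sum_coincidences_le n]
  have hlast : ∫ y, (∑ j ∈ Finset.range n, A y (n - 1) j) ^ 2 ∂iidLaw ν ≤ a * n ^ 2 := by
    have hle : ∫ y, (∑ j ∈ Finset.range n, A y (n - 1) j) ^ 2 ∂iidLaw ν
        ≤ ∫ y, n * ∑ j ∈ Finset.range n, A y (n - 1) j ^ 2 ∂iidLaw ν := by
      refine integral_mono_of_nonneg (ae_of_all _ fun y => sq_nonneg _)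
        ((integrable_finsetSum _ fun j _ => hsq _ j).const_mul _) (ae_of_all _ fun y => ?_)
      simpa using sq_sum_le_card_mul_sum_sq (s := Finset.range n) (f := fun j => A y (n - 1) j)
    rw [integral_const_mul, integral_finsetSum _ fun j _ => hsq _ j] at hle
    have : ∑ j ∈ Finset.range n, ∫ y, A y (n - 1) j ^ 2 ∂iidLaw ν ≤ n * a := by
      refine (Finset.sum_le_sum fun j hj =>
        ha (n - 1) (by omega) j (Finset.mem_range.1 hj)).trans ?_
      simp
    nlinarith
  have hS1 : Integrable (fun y => (∑ p ∈ s, f p y) ^ 2) (iidLaw ν) := by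
    simp_rw [sq, Finset.sum_mul_sum]
    exact integrable_finsetSum _ fun p _ => integrable_finsetSum _ fun q _ => hff p q
  have hS2 : Integrable (fun y => (∑ j ∈ Finset.range n, A y (n - 1) j) ^ 2) (iidLaw ν) := by
    refine integrable_of_abs_le ((Finset.measurable_fun_sum _ fun j _ => hA _ j).pow_const 2)
      (C := (n * M) ^ 2) fun y => ?_
    rw [abs_pow]
    refine pow_le_pow_left₀ (abs_nonneg _) ((Finset.abs_sum_le_sum_abs _ _).trans
      ((Finset.sum_le_sum fun j _ => hM y _ j).trans ?_)) 2
    simp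
  have hle : ∫ y, contrast n (A y) ^ 2 ∂iidLaw ν ≤ ∫ y, (2 / (n : ℝ) ^ 2 * (∑ p ∈ s, f p y) ^ 2
      + 2 / (n : ℝ) ^ 2 * (∑ j ∈ Finset.range n, A y (n - 1) j) ^ 2) ∂iidLaw ν := by
    refine integral_mono_of_nonneg (ae_of_all _ fun y => sq_nonneg _)
      ((hS1.const_mul _).add (hS2.const_mul _)) (ae_of_all _ fun y => ?_)
    simp only [contrast_eq hn, f, s]
    have h0 : (n : ℝ) ≠ 0 := by positivity
    generalize ∑ p ∈ Finset.range (n - 1) ×ˢ Finset.range n,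
      (A y p.1 (p.1 + 1) - A y p.1 p.2) = u
    generalize ∑ j ∈ Finset.range n, A y (n - 1) j = v
    have : (1 / (n : ℝ) * u - 1 / n * v) ^ 2 = 1 / (n : ℝ) ^ 2 * (u - v) ^ 2 := by
      field_simp
    rw [this]
    have h2 : 2 / (n : ℝ) ^ 2 * u ^ 2 + 2 / (n : ℝ) ^ 2 * v ^ 2
        = 1 / (n : ℝ) ^ 2 * (2 * u ^ 2 + 2 * v ^ 2) := by ring
    rw [h2]
    gcongr
    nlinarith [sq_nonneg (u + v)]
  rw [integral_add (hS1.const_mul _) (hS2.const_mul _), integral_const_mul,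
    integral_const_mul] at hle
  refine hle.trans ?_
  have h0 : (0 : ℝ) < n := by linarith
  -- The factors 2 come from (u - v)² ≤ 2u² + 2v²; the boundary row adds 2a ≤ 2na, whence 58 = 56 +
  -- 2.
  calc _ ≤ 2 / (n : ℝ) ^ 2 * (28 * a * n ^ 3) + 2 / (n : ℝ) ^ 2 * (a * n ^ 2) := by gcongr
    _ = 56 * n * a + 2 * a := by field_simp; ring
    _ ≤ 58 * n * a := by nlinarith

end RankCorr

end

/-! ### Bounded kernels, Hoeffding decomposition, degenerate double sums. -/

noncomputable section

namespace RankCorr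

variable {ν : Measure ℝ} [IsProbabilityMeasure ν]

/-- A bounded measurable symmetric kernel. -/
structure BoundedKernel (f : ℝ → ℝ → ℝ) (M : ℝ) : Prop where
  measurable : Measurable fun p : ℝ × ℝ => f p.1 p.2
  bound : ∀ u v, |f u v| ≤ M
  symm : ∀ u v, f u v = f v u

/-- A bounded symmetric kernel all of whose sections are centred. -/
structure DegenerateKernel (ν : Measure ℝ) (ψ : ℝ → ℝ → ℝ) (C : ℝ) : Prop
    extends BoundedKernel ψ C where
  integral_eq_zero : ∀ u, ∫ v, ψ u v ∂ν = 0

/-- The mean of a kernel. -/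
def kernelMean (ν : Measure ℝ) (f : ℝ → ℝ → ℝ) : ℝ := ∫ u, ∫ v, f u v ∂ν ∂ν

/-- The degenerate part in the Hoeffding decomposition of a kernel. -/
def degeneratePart (ν : Measure ℝ) (f : ℝ → ℝ → ℝ) (u v : ℝ) : ℝ :=
  f u v - ∫ w, f u w ∂ν - ∫ w, f v w ∂ν + kernelMean ν f

namespace BoundedKernel

variable {f : ℝ → ℝ → ℝ} {M : ℝ}

lemma measurable_comp (hf : BoundedKernel f M) {S : Type*} [MeasurableSpace S] {a b : S → ℝ}
    (ha : Measurable a) (hb : Measurable b) : Measurable fun s => f (a s) (b s) :=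
  hf.measurable.comp (ha.prodMk hb)

lemma nonneg (hf : BoundedKernel f M) : 0 ≤ M := (abs_nonneg _).trans (hf.bound 0 0)

lemma measurable_pair (hf : BoundedKernel f M) (i j : ℕ) :
    Measurable fun y : ℕ → ℝ => f (y i) (y j) :=
  hf.measurable_comp (measurable_pi_apply i) (measurable_pi_apply j)

lemma measurable_section (hf : BoundedKernel f M) (u : ℝ) : Measurable (f u) :=
  hf.measurable_comp measurable_const measurable_id

lemma integrable_section (hf : BoundedKernel f M) (u : ℝ) : Integrable (f u) ν :=
  integrable_of_abs_le (hf.measurable_section u) (hf.bound u)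

lemma measurable_integral (hf : BoundedKernel f M) : Measurable fun u => ∫ v, f u v ∂ν :=
  (hf.measurable.stronglyMeasurable.integral_prod_right (ν := ν)).measurable

lemma abs_integral_le (hf : BoundedKernel f M) (u : ℝ) : |∫ v, f u v ∂ν| ≤ M :=
  RankCorr.abs_integral_le (hf.bound u)

lemma abs_kernelMean_le (hf : BoundedKernel f M) : |kernelMean ν f| ≤ M :=
  RankCorr.abs_integral_le hf.abs_integral_le

lemma integrable_integral (hf : BoundedKernel f M) : Integrable (fun u => ∫ v, f u v ∂ν) ν :=
  integrable_of_abs_le hf.measurable_integral hf.abs_integral_le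

lemma degenerateKernel (hf : BoundedKernel f M) :
    DegenerateKernel ν (degeneratePart ν f) (4 * M) where
  measurable := ((hf.measurable.sub (hf.measurable_integral.comp measurable_fst)).sub
    (hf.measurable_integral.comp measurable_snd)).add_const _
  bound u v := by
    have h1 := abs_le.1 (hf.bound u v)
    have h2 := abs_le.1 (hf.abs_integral_le (ν := ν) u)
    have h3 := abs_le.1 (hf.abs_integral_le (ν := ν) v)
    have h4 := abs_le.1 (hf.abs_kernelMean_le (ν := ν))
    rw [degeneratePart, abs_le]
    constructor <;> linarith [h1.1, h1.2, h2.1, h2.2, h3.1, h3.2, h4.1, h4.2]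
  symm u v := by rw [degeneratePart, degeneratePart, hf.symm u v]; ring
  integral_eq_zero u := by
    simp only [degeneratePart]
    have h1 : Integrable (fun v => f u v - ∫ w, f u w ∂ν) ν :=
      (hf.integrable_section u).sub (integrable_const _)
    have h2 : Integrable (fun v => f u v - ∫ w, f u w ∂ν - ∫ w, f v w ∂ν) ν :=
      h1.sub hf.integrable_integral
    rw [integral_add h2 (integrable_const _), integral_sub h1 hf.integrable_integral,
      integral_sub (hf.integrable_section u) (integrable_const _)]
    simp [kernelMean]

end BoundedKernel

namespace DegenerateKernel

variable {ψ : ℝ → ℝ → ℝ} {C : ℝ}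

/-- The observation `i` occurs exactly once in the product, and integrating it out gives zero
because the sections of ψ are centred. -/
lemma integral_mul_eq_zero (hψ : DegenerateKernel ν ψ C) {i j k l : ℕ} (hj : i ≠ j) (hk : i ≠ k)
    (hl : i ≠ l) : ∫ y, ψ (y i) (y j) * ψ (y k) (y l) ∂iidLaw ν = 0 := by
  refine integral_iidLaw_eq_zero (integrable_of_abs_le
    ((hψ.measurable_pair i j).mul (hψ.measurable_pair k l)) (C := C * C) fun y => ?_) i fun y => ?_
  · rw [abs_mul]
    exact mul_le_mul (hψ.bound _ _) (hψ.bound _ _) (abs_nonneg _) hψ.nonneg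
  · simp only [Function.update_self, Function.update_of_ne hj.symm, Function.update_of_ne hk.symm,
      Function.update_of_ne hl.symm]
    simp_rw [hψ.symm _ (y j)]
    rw [integral_mul_const, hψ.integral_eq_zero, zero_mul]

/-- The double sum of a degenerate kernel has a second moment of order `n²`. -/
lemma integral_sq_double_sum_le (hψ : DegenerateKernel ν ψ C) (n : ℕ) :
    ∫ y, (∑ i ∈ Finset.range n, ∑ j ∈ Finset.range n, ψ (y i) (y j)) ^ 2 ∂iidLaw ν
      ≤ 3 * n ^ 2 * C ^ 2 := by
  have hn : (0 : ℝ) ≤ n := Nat.cast_nonneg n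
  simp_rw [← Finset.sum_product' (Finset.range n) (Finset.range n)
    (f := fun i j => ψ (_ : ℝ) (_ : ℝ))]
  refine (integral_sq_sum_le (c := fun p q => C ^ 2 *
    ((if p.1 = p.2 then (1 : ℝ) else 0) * (if q.1 = q.2 then 1 else 0)
      + (if p.1 = q.1 then 1 else 0) * (if p.2 = q.2 then 1 else 0)
      + (if p.2 = q.1 then 1 else 0) * (if p.1 = q.2 then 1 else 0))) _
    (fun p _ => hψ.measurable_pair p.1 p.2) (C := C) (fun p _ y => hψ.bound _ _) ?_).trans ?_
  · rintro ⟨i, j⟩ - ⟨k, l⟩ -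
    simp only
    -- Unless the four indices match up in pairs, one of them differs from the other three and the
    -- moment vanishes; symmetry of ψ and of the product moves that index to the first place.
    by_cases hpat : (i = j ∧ k = l) ∨ (i = k ∧ j = l) ∨ (j = k ∧ i = l)
    · have hle : ∫ y, ψ (y i) (y j) * ψ (y k) (y l) ∂iidLaw ν ≤ C ^ 2 * 1 := by
        refine (le_abs_self _).trans (abs_integral_le fun y => ?_)
        rw [abs_mul, sq, mul_one]
        exact mul_le_mul (hψ.bound _ _) (hψ.bound _ _) (abs_nonneg _) hψ.nonneg
      refine hle.trans (mul_le_mul_of_nonneg_left ?_ (sq_nonneg C))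
      have hnn : ∀ (p q : Prop) [Decidable p] [Decidable q],
          (0 : ℝ) ≤ (if p then (1 : ℝ) else 0) * (if q then (1 : ℝ) else 0) := fun p q _ _ => by
        split_ifs <;> norm_num
      have n1 := hnn (i = j) (k = l)
      have n2 := hnn (i = k) (j = l)
      have n3 := hnn (j = k) (i = l)
      rcases hpat with h | h | h <;> rw [if_pos h.1, if_pos h.2] at * <;> linarith
    · have hzero : ∫ y, ψ (y i) (y j) * ψ (y k) (y l) ∂iidLaw ν = 0 := by
        by_cases h1 : i ≠ j ∧ i ≠ k ∧ i ≠ l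
        · exact hψ.integral_mul_eq_zero h1.1 h1.2.1 h1.2.2
        by_cases h2 : j ≠ i ∧ j ≠ k ∧ j ≠ l
        · rw [← hψ.integral_mul_eq_zero h2.1 h2.2.1 h2.2.2]
          exact integral_congr_ae (ae_of_all _ fun y => by
            simp only; rw [hψ.symm (y j) (y i)])
        by_cases h3 : k ≠ l ∧ k ≠ i ∧ k ≠ j
        · rw [← hψ.integral_mul_eq_zero h3.1 h3.2.1 h3.2.2]
          exact integral_congr_ae (ae_of_all _ fun y => mul_comm _ _)
        by_cases h4 : l ≠ k ∧ l ≠ i ∧ l ≠ j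
        · rw [← hψ.integral_mul_eq_zero h4.1 h4.2.1 h4.2.2]
          exact integral_congr_ae (ae_of_all _ fun y => by
            simp only; rw [hψ.symm (y l) (y k)]; exact mul_comm _ _)
        omega
      rw [hzero]
      positivity
  · simp_rw [← Finset.mul_sum]
    -- The pairing `i = j`, `k = l` leaves n choices of `q` but only for diagonal `p`; each of the
    -- other two pairings determines `q`.
    have hle : ∀ i j : ℕ, ∑ q ∈ Finset.range n ×ˢ Finset.range n,
        ((if i = j then (1 : ℝ) else 0) * (if q.1 = q.2 then 1 else 0)
          + (if i = q.1 then 1 else 0) * (if j = q.2 then 1 else 0)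
          + (if j = q.1 then 1 else 0) * (if i = q.2 then 1 else 0))
        ≤ n * (if i = j then 1 else 0) + 2 := by
      intro i j
      have one : ∀ i : ℕ, 0 ≤ ∑ l ∈ Finset.range n, (if i = l then (1 : ℝ) else 0) ∧
          ∑ l ∈ Finset.range n, (if i = l then (1 : ℝ) else 0) ≤ 1 := fun i =>
        ⟨Finset.sum_nonneg fun l _ => by split_ifs <;> norm_num, sum_ite_le_one (by omega)⟩
      simp only [Finset.sum_add_distrib]
      rw [Finset.sum_product, Finset.sum_product, Finset.sum_product]
      have h6 : ∀ i j : ℕ, ∑ k ∈ Finset.range n, ∑ l ∈ Finset.range n,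
          (if i = k then (1 : ℝ) else 0) * (if j = l then (1 : ℝ) else 0)
          = (∑ l ∈ Finset.range n, (if i = l then (1 : ℝ) else 0))
            * ∑ l ∈ Finset.range n, (if j = l then (1 : ℝ) else 0) := fun i j =>
        (Finset.sum_mul_sum _ _ _ _).symm
      rw [h6, h6]
      simp only [← Finset.mul_sum]
      have h1 : ∑ k ∈ Finset.range n, ∑ l ∈ Finset.range n, (if k = l then (1 : ℝ) else 0) ≤ n := by
        refine (Finset.sum_le_sum fun k _ => (one k).2).trans ?_
        simp
      have h2 : (0 : ℝ) ≤ if i = j then (1 : ℝ) else 0 := by split_ifs <;> norm_num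
      have h3 := mul_le_one₀ (one i).2 (one j).1 (one j).2
      have h4 := mul_le_one₀ (one j).2 (one i).1 (one i).2
      have h5 := mul_le_mul_of_nonneg_left h1 h2
      linarith
    have hsum : ∑ p ∈ Finset.range n ×ˢ Finset.range n, ((n : ℝ) * (if p.1 = p.2 then 1 else 0) + 2)
        ≤ 3 * (n : ℝ) ^ 2 := by
      rw [Finset.sum_product]
      have : ∀ i ∈ Finset.range n, ∑ j ∈ Finset.range n,
          ((n : ℝ) * (if i = j then (1 : ℝ) else 0) + 2) ≤ 3 * n := fun i _ => by
        have := sum_ite_le_one (s := Finset.range n) (p := fun x => i = x) (by omega)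
        rw [Finset.sum_add_distrib, ← Finset.mul_sum]
        simp only [Finset.sum_const, Finset.card_range, nsmul_eq_mul]
        nlinarith
      refine (Finset.sum_le_sum this).trans ?_
      simp only [Finset.sum_const, Finset.card_range, nsmul_eq_mul]
      nlinarith
    have := (Finset.sum_le_sum fun p (_ : p ∈ Finset.range n ×ˢ Finset.range n) =>
      hle p.1 p.2).trans hsum
    nlinarith [mul_le_mul_of_nonneg_left this (sq_nonneg C)]

end DegenerateKernel

/-! ### Empirical distribution function and the error of plugging it into a Lipschitz kernel. -/

/-- The empirical distribution function of the first `n` observations. -/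
def empCdf (n : ℕ) (y : ℕ → ℝ) (t : ℝ) : ℝ :=
  (∑ j ∈ Finset.range n, if y j ≤ t then (1 : ℝ) else 0) / n

lemma measurable_empCdf (n i : ℕ) : Measurable fun y : ℕ → ℝ => empCdf n y (y i) := by
  refine Measurable.div_const (Finset.measurable_fun_sum _ fun j _ => ?_) _
  exact Measurable.ite (measurableSet_le (measurable_pi_apply j) (measurable_pi_apply i))
    measurable_const measurable_const

/-- This invariance makes `kernelError` an exchangeable array, as `integral_sq_contrast_le`
requires. -/
lemma empCdf_swap {n p q : ℕ} (hp : p < n) (hq : q < n) (y : ℕ → ℝ) (t : ℝ) :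
    empCdf n (fun l => y (Equiv.swap p q l)) t = empCdf n y t := by
  unfold empCdf
  congr 1
  refine Finset.sum_equiv (Equiv.swap p q) (fun i => ?_) fun i _ => rfl
  simp only [Finset.mem_range, Equiv.swap_apply_def]
  split_ifs <;> omega

/-- The empirical distribution function is `n ^ (-1/2)`-close to the true one, in mean square. -/
lemma integral_sq_empCdf_sub_le {n : ℕ} (hn : 0 < n) (i : ℕ) :
    ∫ y, (empCdf n y (y i) - cdf ν (y i)) ^ 2 ∂iidLaw ν ≤ 2 / n := by
  have hn' : (0 : ℝ) < n := by exact_mod_cast hn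
  have hF : Measurable fun t => cdf ν t := (monotone_cdf ν).measurable
  set e : ℕ → (ℕ → ℝ) → ℝ := fun j y => (if y j ≤ y i then (1 : ℝ) else 0) - cdf ν (y i)
  have he : ∀ j, Measurable (e j) := fun j =>
    (Measurable.ite (measurableSet_le (measurable_pi_apply j) (measurable_pi_apply i))
      measurable_const measurable_const).sub (hF.comp (measurable_pi_apply i))
  have heb : ∀ j y, |e j y| ≤ 1 := fun j y => by
    have h0 := cdf_nonneg ν (y i)
    have h1 := cdf_le_one ν (y i)
    simp only [e, abs_le]
    split_ifs <;> constructor <;> linarith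
  have hprod : ∀ j l y, |e j y * e l y| ≤ 1 := fun j l y => by
    rw [abs_mul]
    exact mul_le_one₀ (heb j y) (abs_nonneg _) (heb l y)
  have hsum : ∫ y, (∑ j ∈ Finset.range n, e j y) ^ 2 ∂iidLaw ν ≤ 2 * n := by
    refine (integral_sq_sum_le (c := fun j l => (if j = l then (1 : ℝ) else 0)
      + (if j = i then 1 else 0)) _ (fun j _ => he j) (fun j _ => heb j) ?_).trans ?_
    · intro j _ l _
      -- For such `j` the factor `e j` is centred in the coordinate `j`, which occurs nowhere else;
      -- `l = i` is allowed. The pairs left over have `j = l` or `j = i`: at most 2n of them.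
      by_cases h : j ≠ l ∧ j ≠ i
      · rw [if_neg h.1, if_neg h.2, add_zero]
        refine (integral_iidLaw_eq_zero (integrable_of_abs_le (g := fun y => e j y * e l y)
          ((he j).mul (he l)) (hprod j l)) j fun y => ?_).le
        simp only [e, Function.update_self, Function.update_of_ne h.1.symm,
          Function.update_of_ne h.2.symm]
        rw [integral_mul_const]
        have hi : Integrable (fun t : ℝ => if t ≤ y i then (1 : ℝ) else 0) ν :=
          integrable_of_abs_le (Measurable.ite measurableSet_Iic measurable_const
            measurable_const) (C := 1) fun t => by split_ifs <;> simp
        have : ∫ t : ℝ, (if t ≤ y i then (1 : ℝ) else 0) ∂ν = cdf ν (y i) := by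
          rw [cdf_eq_real, ← integral_indicator_one measurableSet_Iic]
          refine integral_congr_ae (ae_of_all _ fun t => ?_)
          simp [Set.indicator_apply]
        rw [integral_sub hi (integrable_const _), this]
        simp
      · refine ((le_abs_self _).trans (abs_integral_le (hprod j l))).trans ?_
        have : j = l ∨ j = i := by omega
        rcases this with h | h <;> rw [if_pos h] <;> split_ifs <;> norm_num
    · have : ∀ j ∈ Finset.range n, ∑ l ∈ Finset.range n, ((if j = l then (1 : ℝ) else 0)
          + (if j = i then (1 : ℝ) else 0)) ≤ 1 + n * (if j = i then (1 : ℝ) else 0) := by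
        intro j _
        have := sum_ite_le_one (s := Finset.range n) (p := fun x => j = x) (by omega)
        rw [Finset.sum_add_distrib]
        simp only [Finset.sum_const, Finset.card_range, nsmul_eq_mul]
        linarith
      refine (Finset.sum_le_sum this).trans ?_
      have := sum_ite_le_one (s := Finset.range n) (p := fun x => x = i) (by omega)
      rw [Finset.sum_add_distrib, ← Finset.mul_sum]
      simp only [Finset.sum_const, Finset.card_range, nsmul_eq_mul]
      nlinarith
  have heq : ∀ y : ℕ → ℝ, (empCdf n y (y i) - cdf ν (y i)) ^ 2
      = 1 / (n : ℝ) ^ 2 * (∑ j ∈ Finset.range n, e j y) ^ 2 := fun y => by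
    simp only [e, Finset.sum_sub_distrib, Finset.sum_const, Finset.card_range, nsmul_eq_mul,
      empCdf]
    field_simp
  simp_rw [heq]
  rw [integral_const_mul]
  calc _ ≤ 1 / (n : ℝ) ^ 2 * (2 * n) := by gcongr
    _ = 2 / n := by field_simp

/-- A bounded Lipschitz kernel vanishing on the diagonal. -/
structure LipKernel (k : ℝ → ℝ → ℝ) (K M : ℝ) : Prop where
  lip : ∀ u v u' v', |k u v - k u' v'| ≤ K * (|u - u'| + |v - v'|)
  symm : ∀ u v, k u v = k v u
  diag : ∀ u, k u u = 0
  bound : ∀ u v, |k u v| ≤ M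

namespace LipKernel

variable {k : ℝ → ℝ → ℝ} {K M : ℝ}

lemma continuous (hk : LipKernel k K M) : Continuous fun p : ℝ × ℝ => k p.1 p.2 := by
  refine continuous_iff_continuousAt.2 fun p => ?_
  rw [ContinuousAt, tendsto_iff_dist_tendsto_zero]
  have hlim : Tendsto (fun q : ℝ × ℝ => K * (|q.1 - p.1| + |q.2 - p.2|)) (𝓝 p) (𝓝 0) := by
    have : Continuous fun q : ℝ × ℝ => K * (|q.1 - p.1| + |q.2 - p.2|) := by fun_prop
    simpa using this.tendsto p
  exact squeeze_zero (fun _ => dist_nonneg) (fun q => hk.lip _ _ _ _) hlim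

lemma boundedKernel_comp (hk : LipKernel k K M) {F : ℝ → ℝ} (hF : Measurable F) :
    BoundedKernel (fun u v => k (F u) (F v)) M where
  measurable := hk.continuous.measurable.comp (g := fun p : ℝ × ℝ => k p.1 p.2)
    (f := fun p : ℝ × ℝ => (F p.1, F p.2)) (by fun_prop)
  bound u v := hk.bound _ _
  symm u v := hk.symm _ _

lemma measurable_comp (hk : LipKernel k K M) {S : Type*} [MeasurableSpace S] {a b : S → ℝ}
    (ha : Measurable a) (hb : Measurable b) : Measurable fun s => k (a s) (b s) :=
  hk.continuous.measurable.comp (g := fun p : ℝ × ℝ => k p.1 p.2) (ha.prodMk hb)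

end LipKernel

/-- The error in the kernel when the empirical distribution function replaces the true one. -/
def kernelError (ν : Measure ℝ) (k : ℝ → ℝ → ℝ) (n : ℕ) (y : ℕ → ℝ) (i j : ℕ) : ℝ :=
  k (empCdf n y (y i)) (empCdf n y (y j)) - k (cdf ν (y i)) (cdf ν (y j))

namespace LipKernel

variable {k : ℝ → ℝ → ℝ} {K M : ℝ}

lemma measurable_kernelError (hk : LipKernel k K M) (n i j : ℕ) :
    Measurable fun y => kernelError ν k n y i j :=
  have hF : Measurable fun t => cdf ν t := (monotone_cdf ν).measurable
  (hk.measurable_comp (measurable_empCdf n i) (measurable_empCdf n j)).sub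
    (hk.measurable_comp (hF.comp (measurable_pi_apply i)) (hF.comp (measurable_pi_apply j)))

lemma abs_kernelError_le (hk : LipKernel k K M) (n : ℕ) (y : ℕ → ℝ) (i j : ℕ) :
    |kernelError ν k n y i j| ≤ 2 * M :=
  (abs_sub _ _).trans (by
    linarith [hk.bound (empCdf n y (y i)) (empCdf n y (y j)),
      hk.bound (cdf ν (y i)) (cdf ν (y j))])

/-- The Lipschitz property transfers the mean-square rate 2/n of the empirical distribution function
at each of the two arguments. -/
lemma integral_sq_kernelError_le (hk : LipKernel k K M) {n : ℕ} (hn : 0 < n) (i j : ℕ) :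
    ∫ y, kernelError ν k n y i j ^ 2 ∂iidLaw ν ≤ 8 * K ^ 2 / n := by
  have hF : Measurable fun t => cdf ν t := (monotone_cdf ν).measurable
  have hint : ∀ i, Integrable (fun y => (empCdf n y (y i) - cdf ν (y i)) ^ 2) (iidLaw ν) := by
    intro i
    refine integrable_of_abs_le (((measurable_empCdf n i).sub
      (hF.comp (measurable_pi_apply i))).pow_const 2) (C := 1) fun y => ?_
    have h0 := cdf_nonneg ν (y i)
    have h1 := cdf_le_one ν (y i)
    have h2 : 0 ≤ empCdf n y (y i) :=
      div_nonneg (Finset.sum_nonneg fun j _ => by split_ifs <;> norm_num) (Nat.cast_nonneg n)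
    have h3 : empCdf n y (y i) ≤ 1 := by
      refine div_le_one_of_le₀ ?_ (Nat.cast_nonneg n)
      refine (Finset.sum_le_sum (g := fun _ => (1 : ℝ)) fun j _ => ?_).trans (by simp)
      split_ifs <;> norm_num
    rw [abs_pow, sq_le_one_iff₀ (abs_nonneg _), abs_le]
    constructor <;> linarith
  have hle : ∫ y, kernelError ν k n y i j ^ 2 ∂iidLaw ν
      ≤ ∫ y, (2 * K ^ 2 * (empCdf n y (y i) - cdf ν (y i)) ^ 2
        + 2 * K ^ 2 * (empCdf n y (y j) - cdf ν (y j)) ^ 2) ∂iidLaw ν := by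
    refine integral_mono_of_nonneg (ae_of_all _ fun y => sq_nonneg _)
      (((hint i).const_mul _).add ((hint j).const_mul _)) (ae_of_all _ fun y => ?_)
    simp only
    have h := hk.lip (empCdf n y (y i)) (empCdf n y (y j)) (cdf ν (y i)) (cdf ν (y j))
    have h2 := pow_le_pow_left₀ (abs_nonneg _) h 2
    rw [sq_abs] at h2
    rw [← sq_abs (empCdf n y (y i) - _), ← sq_abs (empCdf n y (y j) - _)]
    refine h2.trans ?_
    generalize |empCdf n y (y i) - _| = a
    generalize |empCdf n y (y j) - _| = b
    nlinarith [mul_nonneg (sq_nonneg K) (sq_nonneg (a - b))]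
  rw [integral_add ((hint i).const_mul _) ((hint j).const_mul _), integral_const_mul,
    integral_const_mul] at hle
  refine hle.trans ?_
  have hi := integral_sq_empCdf_sub_le (ν := ν) hn i
  have hj := integral_sq_empCdf_sub_le (ν := ν) hn j
  calc _ ≤ 2 * K ^ 2 * (2 / n) + 2 * K ^ 2 * (2 / n) := by gcongr
    _ = 8 * K ^ 2 / n := by ring

/-- Exchangeability gives 58 · n · (8K²/n), bounded in n; hence using ranks instead of true
distribution function values does not affect the limit of the contrast divided by √n. -/
lemma integral_sq_contrast_kernelError_le (hk : LipKernel k K M) {n : ℕ} (hn : 0 < n) :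
    ∫ y, contrast n (kernelError ν k n y) ^ 2 ∂iidLaw ν ≤ 464 * K ^ 2 := by
  have hn' : (0 : ℝ) < n := by exact_mod_cast hn
  refine (integral_sq_contrast_le hn (hk.measurable_kernelError n) (hk.abs_kernelError_le n)
    (fun p hp q hq y i j => ?_) (fun i _ j _ => hk.integral_sq_kernelError_le hn i j)).trans ?_
  · simp only [kernelError, empCdf_swap hp hq]
  · refine le_of_eq ?_
    field_simp
    ring

end LipKernel

end RankCorr

end

/-! ### McLeish's central limit theorem for a degenerate kernel along a path. -/

noncomputable section

namespace RankCorr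

variable {ν : Measure ℝ} [IsProbabilityMeasure ν]

/-- The added x²/2 cancels the quadratic term of exp(ix), so only terms of order three and higher
remain. -/
lemma norm_exp_sub_le {x : ℝ} (hx : |x| ≤ 1) :
    ‖Complex.exp (x * Complex.I + (x ^ 2 / 2 : ℝ)) - (1 + x * Complex.I)‖ ≤ 30 * |x| ^ 3 := by
  set z : ℂ := x * Complex.I + (x ^ 2 / 2 : ℝ)
  have hx0 := abs_nonneg x
  have hz : ‖z‖ ≤ 3 / 2 * |x| := by
    refine (norm_add_le _ _).trans ?_
    rw [norm_mul, Complex.norm_I, Complex.norm_real, Complex.norm_real, Real.norm_eq_abs,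
      Real.norm_eq_abs, abs_div, abs_pow, abs_two]
    nlinarith
  have h := Complex.norm_exp_sub_sum_le_norm_mul_exp z 3
  have hexp : Real.exp ‖z‖ ≤ 7.5 := by
    have h1 : Real.exp ‖z‖ ≤ Real.exp (1 + 1) := Real.exp_le_exp.2 (by linarith)
    rw [Real.exp_add] at h1
    have := Real.exp_one_lt_d9
    have := Real.exp_pos 1
    nlinarith
  have hz3 : ‖z‖ ^ 3 * Real.exp ‖z‖ ≤ 27 / 8 * |x| ^ 3 * 7.5 := by
    have : ‖z‖ ^ 3 ≤ (3 / 2 * |x|) ^ 3 := pow_le_pow_left₀ (norm_nonneg _) hz 3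
    have h27 : (3 / 2 * |x|) ^ 3 = 27 / 8 * |x| ^ 3 := by ring
    rw [h27] at this
    exact mul_le_mul this hexp (Real.exp_pos _).le (by positivity)
  have hrest : ‖(x : ℂ) ^ 3 * Complex.I / 2 + (x : ℂ) ^ 4 / 8‖ ≤ |x| ^ 3 := by
    refine (norm_add_le _ _).trans ?_
    simp only [norm_div, norm_mul, norm_pow, Complex.norm_I, Complex.norm_real, Real.norm_eq_abs,
      Complex.norm_ofNat]
    nlinarith [pow_nonneg hx0 3]
  -- With z = ix + x²/2, z²/2 = -x²/2 + ix³/2 + x⁴/8, whose first term cancels the x²/2 in z.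
  have heq : Complex.exp z - (1 + x * Complex.I)
      = (Complex.exp z - ∑ m ∈ Finset.range 3, z ^ m / (m.factorial : ℂ))
        + ((x : ℂ) ^ 3 * Complex.I / 2 + (x : ℂ) ^ 4 / 8) := by
    simp only [Finset.sum_range_succ, Finset.sum_range_zero, z, Nat.factorial]
    push_cast
    linear_combination (x : ℂ) ^ 2 / 2 * Complex.I_sq
  rw [heq]
  refine (norm_add_le _ _).trans ?_
  linarith [pow_nonneg hx0 3]

/-- Telescoping: the factors are replaced one at a time. `1 ≤ B` allows the exponent m in place of m
- 1. -/
lemma norm_prod_sub_prod_le {a b : ℕ → ℂ} {B ε : ℝ} (hB : 1 ≤ B) (ha : ∀ i, ‖a i‖ ≤ B)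
    (hb : ∀ i, ‖b i‖ ≤ B) (hab : ∀ i, ‖a i - b i‖ ≤ ε) (m : ℕ) :
    ‖∏ i ∈ Finset.range m, a i - ∏ i ∈ Finset.range m, b i‖ ≤ m * ε * B ^ m := by
  have hε : 0 ≤ ε := (norm_nonneg _).trans (hab 0)
  induction m with
  | zero => simp
  | succ m ih =>
    have hprod : ‖∏ i ∈ Finset.range m, b i‖ ≤ B ^ m := by
      rw [norm_prod]
      exact (Finset.prod_le_prod (fun i _ => norm_nonneg _) fun i _ => hb i).trans (by simp)
    rw [Finset.prod_range_succ, Finset.prod_range_succ]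
    have heq : (∏ i ∈ Finset.range m, a i) * a m - (∏ i ∈ Finset.range m, b i) * b m
        = (∏ i ∈ Finset.range m, a i - ∏ i ∈ Finset.range m, b i) * a m
          + (∏ i ∈ Finset.range m, b i) * (a m - b m) := by ring
    rw [heq]
    refine (norm_add_le _ _).trans ?_
    rw [norm_mul, norm_mul]
    have h1 : ‖∏ i ∈ Finset.range m, a i - ∏ i ∈ Finset.range m, b i‖ * ‖a m‖
        ≤ m * ε * B ^ m * B := mul_le_mul ih (ha m) (norm_nonneg _) (by positivity)
    have h2 : ‖∏ i ∈ Finset.range m, b i‖ * ‖a m - b m‖ ≤ B ^ m * ε :=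
      mul_le_mul hprod (hab m) (norm_nonneg _) (by positivity)
    have h3 : B ^ m * ε ≤ B ^ m * ε * B := le_mul_of_one_le_right (by positivity) hB
    push_cast
    rw [pow_succ]
    linarith

/-- The squared modulus is 1 + x² ≤ exp(x²). The bound equals the modulus of exp(ix + x²/2), so both
products compared below have the same control. -/
lemma norm_one_add_mul_I_le (x : ℝ) : ‖1 + (x : ℂ) * Complex.I‖ ≤ Real.exp (x ^ 2 / 2) := by
  have h : ‖1 + (x : ℂ) * Complex.I‖ ^ 2 = 1 + x ^ 2 := by
    rw [← Complex.normSq_eq_norm_sq, Complex.normSq_apply]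
    simp
    ring
  refine le_of_sq_le_sq ?_ (Real.exp_pos _).le
  rw [h, ← Real.exp_nat_mul]
  have := Real.add_one_le_exp (x ^ 2)
  push_cast
  rw [show (2 : ℝ) * (x ^ 2 / 2) = x ^ 2 by ring]
  linarith

/-- McLeish's exponential comparison. -/
lemma norm_exp_sum_sub_prod_le {x : ℕ → ℝ} {δ : ℝ} (hδ : δ ≤ 1) (hx : ∀ i, |x i| ≤ δ) (m : ℕ) :
    ‖Complex.exp ((∑ i ∈ Finset.range m, x i : ℝ) * Complex.I
        + ((∑ i ∈ Finset.range m, x i ^ 2) / 2 : ℝ))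
      - ∏ i ∈ Finset.range m, (1 + (x i : ℂ) * Complex.I)‖
      ≤ m * (30 * δ ^ 3) * Real.exp (m * δ ^ 2 / 2) := by
  have hδ0 : 0 ≤ δ := (abs_nonneg _).trans (hx 0)
  have hsq : ∀ i, Real.exp (x i ^ 2 / 2) ≤ Real.exp (δ ^ 2 / 2) := fun i => by
    rw [Real.exp_le_exp, ← sq_abs]
    gcongr
    exact hx i
  have h := norm_prod_sub_prod_le
    (a := fun i => Complex.exp (x i * Complex.I + (x i ^ 2 / 2 : ℝ)))
    (b := fun i => 1 + (x i : ℂ) * Complex.I) (B := Real.exp (δ ^ 2 / 2)) (ε := 30 * δ ^ 3)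
    (Real.one_le_exp (by positivity)) (fun i => ?_)
    (fun i => (norm_one_add_mul_I_le _).trans (hsq i))
    (fun i => (norm_exp_sub_le ((hx i).trans hδ)).trans ?_) m
  · rw [← Real.exp_nat_mul, ← Complex.exp_sum] at h
    convert h using 4
    · rw [Finset.sum_add_distrib, ← Finset.sum_mul]
      push_cast
      rw [Finset.sum_div]
    · ring
  · rw [Complex.norm_exp]
    refine le_of_eq_of_le ?_ (hsq i)
    simp [-Complex.ofReal_pow]
  · have := pow_le_pow_left₀ (abs_nonneg _) (hx i) 3
    linarith

namespace DegenerateKernel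

variable {ψ : ℝ → ℝ → ℝ} {C : ℝ}

/-- The newest observation enters only the last factor, and integrating it out turns that factor
into 1, since the sections of ψ are centred. -/
lemma integral_prod_eq_one (hψ : DegenerateKernel ν ψ C) (c : ℝ) (m : ℕ) :
    ∫ y, ∏ i ∈ Finset.range m, (1 + ((c * ψ (y i) (y (i + 1)) : ℝ) : ℂ) * Complex.I) ∂iidLaw ν
      = 1 := by
  have hmeas : ∀ i, Measurable fun y : ℕ → ℝ => ((c * ψ (y i) (y (i + 1)) : ℝ) : ℂ) := fun i =>
    Complex.measurable_ofReal.comp ((hψ.measurable_pair i (i + 1)).const_mul c)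
  have hb : ∀ i (y : ℕ → ℝ), ‖((c * ψ (y i) (y (i + 1)) : ℝ) : ℂ)‖ ≤ |c| * C := fun i y => by
    rw [Complex.norm_real, Real.norm_eq_abs, abs_mul]
    exact mul_le_mul_of_nonneg_left (hψ.bound _ _) (abs_nonneg _)
  have hb1 : ∀ i (y : ℕ → ℝ),
      ‖1 + ((c * ψ (y i) (y (i + 1)) : ℝ) : ℂ) * Complex.I‖ ≤ 1 + |c| * C := fun i y => by
    refine (norm_add_le _ _).trans ?_
    rw [norm_mul, Complex.norm_I, mul_one, norm_one]
    linarith [hb i y]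
  have hC : 0 ≤ |c| * C := mul_nonneg (abs_nonneg _) hψ.nonneg
  have hpm : ∀ m, Measurable fun y : ℕ → ℝ =>
      ∏ i ∈ Finset.range m, (1 + ((c * ψ (y i) (y (i + 1)) : ℝ) : ℂ) * Complex.I) := fun m =>
    Finset.measurable_fun_prod _ fun i _ => ((hmeas i).mul_const _).const_add _
  have hpb : ∀ m (y : ℕ → ℝ),
      ‖∏ i ∈ Finset.range m, (1 + ((c * ψ (y i) (y (i + 1)) : ℝ) : ℂ) * Complex.I)‖
        ≤ (1 + |c| * C) ^ m := fun m y => by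
    rw [norm_prod]
    exact (Finset.prod_le_prod (fun i _ => norm_nonneg _) fun i _ => hb1 i y).trans (by simp)
  induction m with
  | zero => simp
  | succ m ih =>
    simp_rw [Finset.prod_range_succ, mul_add, mul_one]
    have hint2 : Integrable (fun y : ℕ → ℝ =>
        (∏ i ∈ Finset.range m, (1 + ((c * ψ (y i) (y (i + 1)) : ℝ) : ℂ) * Complex.I))
          * (((c * ψ (y m) (y (m + 1)) : ℝ) : ℂ) * Complex.I)) (iidLaw ν) := by
      refine Integrable.of_bound ((hpm m).mul ((hmeas m).mul_const _)).aestronglyMeasurable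
        ((1 + |c| * C) ^ m * (|c| * C)) (ae_of_all _ fun y => ?_)
      rw [norm_mul, norm_mul, Complex.norm_I, mul_one]
      exact mul_le_mul (hpb m y) (hb m y) (norm_nonneg _) (by positivity)
    rw [integral_add (Integrable.of_bound (hpm m).aestronglyMeasurable _
      (ae_of_all _ (hpb m))) hint2, ih, integral_iidLaw_eq_zero hint2 (m + 1), add_zero]
    intro y
    have hprod : ∀ t, ∏ i ∈ Finset.range m, (1 + ((c * ψ (Function.update y (m + 1) t i)
          (Function.update y (m + 1) t (i + 1)) : ℝ) : ℂ) * Complex.I)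
        = ∏ i ∈ Finset.range m, (1 + ((c * ψ (y i) (y (i + 1)) : ℝ) : ℂ) * Complex.I) := by
      intro t
      refine Finset.prod_congr rfl fun i hi => ?_
      have := Finset.mem_range.1 hi
      rw [Function.update_of_ne (by omega), Function.update_of_ne (by omega)]
    simp only [hprod, Function.update_self, Function.update_of_ne (Nat.succ_ne_self m).symm]
    rw [integral_const_mul, integral_mul_const, integral_complex_ofReal, integral_const_mul,
      hψ.integral_eq_zero]
    simp

/-- The variance of a degenerate kernel. -/
def _root_.RankCorr.kernelVar (ν : Measure ℝ) (ψ : ℝ → ℝ → ℝ) : ℝ := ∫ u, ∫ v, ψ u v ^ 2 ∂ν ∂ν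

lemma sq_mem (hψ : DegenerateKernel ν ψ C) (u v : ℝ) : 0 ≤ ψ u v ^ 2 ∧ ψ u v ^ 2 ≤ C ^ 2 :=
  ⟨sq_nonneg _, by rw [← sq_abs]; exact pow_le_pow_left₀ (abs_nonneg _) (hψ.bound u v) 2⟩

lemma boundedKernel_sq (hψ : DegenerateKernel ν ψ C) :
    BoundedKernel (fun u v => ψ u v ^ 2) (C ^ 2) where
  measurable := hψ.measurable.pow_const 2
  bound u v := by rw [abs_of_nonneg (sq_nonneg _)]; exact (hψ.sq_mem u v).2
  symm u v := by rw [hψ.symm]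

lemma kernelVar_nonneg (ψ : ℝ → ℝ → ℝ) : 0 ≤ kernelVar ν ψ :=
  integral_nonneg fun u => integral_nonneg fun v => sq_nonneg (ψ u v)

lemma kernelVar_le (hψ : DegenerateKernel ν ψ C) : kernelVar ν ψ ≤ C ^ 2 :=
  (le_abs_self _).trans hψ.boundedKernel_sq.abs_kernelMean_le

/-- Law of large numbers for the squares along the path. -/
lemma integral_sq_sub_kernelVar_le (hψ : DegenerateKernel ν ψ C) {n : ℕ} (hn : 0 < n) :
    ∫ y, ((∑ i ∈ Finset.range (n - 1), ψ (y i) (y (i + 1)) ^ 2) / n - kernelVar ν ψ) ^ 2 ∂iidLaw ν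
      ≤ 9 * C ^ 4 / n := by
  have hn' : (1 : ℝ) ≤ n := by exact_mod_cast hn
  have hn1 : ((n - 1 : ℕ) : ℝ) = n - 1 := by rw [Nat.cast_sub hn]; simp
  have hq := hψ.boundedKernel_sq
  have hv0 : ∀ u, 0 ≤ ∫ v, ψ u v ^ 2 ∂ν := fun u => integral_nonneg fun v => sq_nonneg _
  have hv1 : ∀ u, ∫ v, ψ u v ^ 2 ∂ν ≤ C ^ 2 := fun u =>
    (le_abs_self _).trans (hq.abs_integral_le u)
  have hs0 := kernelVar_nonneg (ν := ν) ψ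
  have hs1 := hψ.kernelVar_le
  -- The squares along the path are 1-dependent. Here `a` is centred given the past and `b` is an
  -- i.i.d. centred sequence, so each is orthogonal; a third term appears because n - 1 squares are
  -- divided by n.
  set a : ℕ → (ℕ → ℝ) → ℝ := fun i y => ψ (y i) (y (i + 1)) ^ 2 - ∫ v, ψ (y i) v ^ 2 ∂ν
  set b : ℕ → (ℕ → ℝ) → ℝ := fun i y => ∫ v, ψ (y i) v ^ 2 ∂ν - kernelVar ν ψ
  have hvm : Measurable fun u => ∫ v, ψ u v ^ 2 ∂ν := hq.measurable_integral
  have ham : ∀ i, Measurable (a i) := fun i =>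
    ((hψ.measurable_pair i (i + 1)).pow_const 2).sub (hvm.comp (measurable_pi_apply i))
  have hbm : ∀ i, Measurable (b i) := fun i => (hvm.comp (measurable_pi_apply i)).sub_const _
  have hab : ∀ i y, |a i y| ≤ C ^ 2 := fun i y => by
    simp only [a, abs_le]
    constructor <;> linarith [hv0 (y i), hv1 (y i), (hψ.sq_mem (y i) (y (i + 1))).1,
      (hψ.sq_mem (y i) (y (i + 1))).2]
  have hbb : ∀ i y, |b i y| ≤ C ^ 2 := fun i y => by
    simp only [b, abs_le]
    constructor <;> linarith [hv0 (y i), hv1 (y i)]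
  have hprod : ∀ {f : ℕ → (ℕ → ℝ) → ℝ}, (∀ i, Measurable (f i)) → (∀ i y, |f i y| ≤ C ^ 2) →
      ∀ i j, Integrable (fun y => f i y * f j y) (iidLaw ν) := fun hf hfb i j =>
    integrable_of_abs_le ((hf i).mul (hf j)) (C := C ^ 2 * C ^ 2) fun y => by
      rw [abs_mul]
      exact mul_le_mul (hfb i y) (hfb j y) (abs_nonneg _) (sq_nonneg _)
  have ha := integral_sq_sum_le_of_orthogonal (P := iidLaw ν) (n := n - 1) ham hab
    fun i j hij => by
      refine integral_iidLaw_eq_zero (hprod ham hab i j) (j + 1) fun y => ?_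
      simp only [a, Function.update_self, Function.update_of_ne (Nat.succ_ne_self j).symm,
        Function.update_of_ne (show i ≠ j + 1 by omega),
        Function.update_of_ne (show i + 1 ≠ j + 1 by omega)]
      rw [integral_const_mul, integral_sub (hq.integrable_section _) (integrable_const _)]
      simp
  have hb := integral_sq_sum_le_of_orthogonal (P := iidLaw ν) (n := n - 1) hbm hbb
    fun i j hij => by
      refine integral_iidLaw_eq_zero (hprod hbm hbb i j) j fun y => ?_
      simp only [b, Function.update_self, Function.update_of_ne (show i ≠ j by omega)]
      rw [integral_const_mul, integral_sub hq.integrable_integral (integrable_const _)]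
      simp [kernelVar]
  rw [hn1] at ha hb
  have hint : ∀ {f : ℕ → (ℕ → ℝ) → ℝ}, (∀ i, Measurable (f i)) → (∀ i y, |f i y| ≤ C ^ 2) →
      Integrable (fun y => (∑ i ∈ Finset.range (n - 1), f i y) ^ 2) (iidLaw ν) := fun hf hfb => by
    simp_rw [sq, Finset.sum_mul_sum]
    exact integrable_finsetSum _ fun i _ => integrable_finsetSum _ fun j _ => hprod hf hfb i j
  have hia := (hint ham hab).const_mul (3 / (n : ℝ) ^ 2)
  have hib := (hint hbm hbb).const_mul (3 / (n : ℝ) ^ 2)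
  have hle : ∫ y, ((∑ i ∈ Finset.range (n - 1), ψ (y i) (y (i + 1)) ^ 2) / n
        - kernelVar ν ψ) ^ 2 ∂iidLaw ν
      ≤ ∫ y, (3 / (n : ℝ) ^ 2 * (∑ i ∈ Finset.range (n - 1), a i y) ^ 2
        + 3 / (n : ℝ) ^ 2 * (∑ i ∈ Finset.range (n - 1), b i y) ^ 2
        + 3 / (n : ℝ) ^ 2 * kernelVar ν ψ ^ 2) ∂iidLaw ν := by
    refine integral_mono_of_nonneg (ae_of_all _ fun y => sq_nonneg _)
      ((hia.add hib).add (integrable_const _)) (ae_of_all _ fun y => ?_)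
    simp only
    have hdec : (∑ i ∈ Finset.range (n - 1), ψ (y i) (y (i + 1)) ^ 2) / n - kernelVar ν ψ
        = (∑ i ∈ Finset.range (n - 1), a i y + ∑ i ∈ Finset.range (n - 1), b i y
          - kernelVar ν ψ) / n := by
      simp only [a, b, Finset.sum_sub_distrib, Finset.sum_const, Finset.card_range, nsmul_eq_mul,
        hn1]
      field_simp
      ring
    rw [hdec, div_pow, div_mul_eq_mul_div, div_mul_eq_mul_div, div_mul_eq_mul_div, ← add_div,
      ← add_div]
    gcongr
    generalize ∑ i ∈ Finset.range (n - 1), a i y = p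
    generalize ∑ i ∈ Finset.range (n - 1), b i y = q
    nlinarith [sq_nonneg (p - q), sq_nonneg (p + kernelVar ν ψ), sq_nonneg (q + kernelVar ν ψ)]
  rw [integral_add (f := fun y => 3 / (n : ℝ) ^ 2 * (∑ i ∈ Finset.range (n - 1), a i y) ^ 2
        + 3 / (n : ℝ) ^ 2 * (∑ i ∈ Finset.range (n - 1), b i y) ^ 2) (hia.add hib)
      (integrable_const _), integral_add hia hib, integral_const_mul,
    integral_const_mul, integral_const, probReal_univ, one_smul] at hle
  refine hle.trans ?_
  have hC2 : (C ^ 2) ^ 2 = C ^ 4 := by ring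
  rw [hC2] at ha hb
  have hs2 : kernelVar ν ψ ^ 2 ≤ C ^ 4 := hC2 ▸ pow_le_pow_left₀ hs0 hs1 2
  have hC4 : 0 ≤ C ^ 4 := by positivity
  calc _ ≤ 3 / (n : ℝ) ^ 2 * (n * C ^ 4) + 3 / (n : ℝ) ^ 2 * (n * C ^ 4)
        + 3 / (n : ℝ) ^ 2 * (n * C ^ 4) := by gcongr <;> nlinarith
    _ = 9 * C ^ 4 / n := by field_simp; ring

/-- Let S be the exponent, V the normalized sum of squares and T the product of the factors 1 + ixⱼ.
Pointwise exp(iS + t²V/2) is close to T, which has mean exactly 1. As V concentrates at the constant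
`kernelVar ν ψ`, it can be replaced by it, and the mean of exp(iS) is close to exp(-t² · `kernelVar
ν ψ` / 2). -/
lemma tendsto_charFun (hψ : DegenerateKernel ν ψ C) (t : ℝ) :
    Tendsto (fun n : ℕ => ∫ y, Complex.exp (((t / √n * ∑ i ∈ Finset.range (n - 1),
      ψ (y i) (y (i + 1)) : ℝ) : ℂ) * Complex.I) ∂iidLaw ν) atTop
      (𝓝 (Complex.exp ((-(t ^ 2 * kernelVar ν ψ / 2) : ℝ) : ℂ))) := by
  set s2 := kernelVar ν ψ
  have hs0 : 0 ≤ s2 := kernelVar_nonneg ψ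
  have hs1 : s2 ≤ C ^ 2 := hψ.kernelVar_le
  set R : ℝ := 30 * (|t| * C) ^ 3 * Real.exp (t ^ 2 * C ^ 2 / 2)
    + Real.exp (t ^ 2 * C ^ 2 / 2) * (t ^ 2 / 2) * ((9 * C ^ 4 + 1) / 2)
  have hC := hψ.nonneg
  have hbound : ∀ᶠ n : ℕ in atTop, ‖(∫ y, Complex.exp (((t / √n * ∑ i ∈ Finset.range (n - 1),
      ψ (y i) (y (i + 1)) : ℝ) : ℂ) * Complex.I) ∂iidLaw ν)
        * Complex.exp ((t ^ 2 * s2 / 2 : ℝ) : ℂ) - 1‖ ≤ R / √n := by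
    have hlarge : Tendsto (fun n : ℕ => √(n : ℝ)) atTop atTop :=
      Real.tendsto_sqrt_atTop.comp tendsto_natCast_atTop_atTop
    filter_upwards [eventually_gt_atTop 0, hlarge.eventually_ge_atTop (|t| * C)] with n hn hnt
    have hn' : (0 : ℝ) < n := by exact_mod_cast hn
    have hsq : 0 < √(n : ℝ) := Real.sqrt_pos.2 hn'
    have hss : √(n : ℝ) ^ 2 = n := Real.sq_sqrt hn'.le
    set m := n - 1
    have hmn : (m : ℝ) ≤ n := by exact_mod_cast Nat.sub_le n 1
    set S : (ℕ → ℝ) → ℝ := fun y => t / √n * ∑ i ∈ Finset.range m, ψ (y i) (y (i + 1))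
    set V : (ℕ → ℝ) → ℝ := fun y => (∑ i ∈ Finset.range m, ψ (y i) (y (i + 1)) ^ 2) / n
    set T : (ℕ → ℝ) → ℂ := fun y =>
      ∏ i ∈ Finset.range m, (1 + ((t / √n * ψ (y i) (y (i + 1)) : ℝ) : ℂ) * Complex.I)
    have hSm : Measurable S := (Finset.measurable_fun_sum _ fun i _ =>
      hψ.measurable_pair i (i + 1)).const_mul _
    have hVm : Measurable V := (Finset.measurable_fun_sum _ fun i _ =>
      (hψ.measurable_pair i (i + 1)).pow_const 2).div_const _
    have hV0 : ∀ y, 0 ≤ V y := fun y =>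
      div_nonneg (Finset.sum_nonneg fun i _ => sq_nonneg _) hn'.le
    have hV1 : ∀ y, V y ≤ C ^ 2 := fun y => by
      rw [div_le_iff₀ hn']
      refine (Finset.sum_le_sum fun i _ => (hψ.sq_mem _ _).2).trans ?_
      simp only [Finset.sum_const, Finset.card_range, nsmul_eq_mul]
      nlinarith [sq_nonneg C]
    have hST : ∀ y, ‖Complex.exp (S y * Complex.I + (t ^ 2 * V y / 2 : ℝ)) - T y‖
        ≤ 30 * (|t| * C) ^ 3 * Real.exp (t ^ 2 * C ^ 2 / 2) / √n := by
      intro y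
      have h := norm_exp_sum_sub_prod_le (x := fun i => t / √n * ψ (y i) (y (i + 1)))
        (δ := |t| * C / √n) ((div_le_one hsq).2 hnt) (fun i => ?_) m
      · have hS : ∑ i ∈ Finset.range m, t / √n * ψ (y i) (y (i + 1)) = S y := by
          simp only [S, Finset.mul_sum]
        have hV : (∑ i ∈ Finset.range m, (t / √n * ψ (y i) (y (i + 1))) ^ 2) / 2
            = t ^ 2 * V y / 2 := by
          simp only [V, mul_pow, ← Finset.mul_sum, div_pow, hss]
          ring
        rw [hS, hV] at h
        refine h.trans ?_
        have e1 : (m : ℝ) * (|t| * C / √n) ^ 2 / 2 ≤ t ^ 2 * C ^ 2 / 2 := by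
          rw [div_pow, mul_pow, sq_abs, hss]
          refine div_le_div_of_nonneg_right ?_ zero_le_two
          rw [mul_div_assoc', div_le_iff₀ hn', mul_comm]
          gcongr
        have e2 : (m : ℝ) * (30 * (|t| * C / √n) ^ 3) ≤ 30 * (|t| * C) ^ 3 / √n := by
          have h3 : 30 * (|t| * C / √n) ^ 3 = 30 * (|t| * C) ^ 3 / √n / n := by
            rw [div_pow, div_div, mul_div_assoc, pow_succ (√(n : ℝ)) 2, hss, mul_comm (n : ℝ)]
          rw [h3, mul_div_assoc', div_le_iff₀ hn', mul_comm]
          gcongr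
        calc _ ≤ 30 * (|t| * C) ^ 3 / √n * Real.exp (t ^ 2 * C ^ 2 / 2) := by gcongr
          _ = _ := by ring
      · rw [abs_mul, abs_div, abs_of_pos hsq, div_mul_eq_mul_div]
        gcongr
        exact hψ.bound _ _
    have hexp : ∀ y, |Real.exp (t ^ 2 * s2 / 2) - Real.exp (t ^ 2 * V y / 2)|
        ≤ Real.exp (t ^ 2 * C ^ 2 / 2) * (t ^ 2 / 2) * |V y - s2| := by
      -- exp q - exp p = exp q (1 - exp(p - q)) ≤ exp q (q - p).
      have haux : ∀ {p q : ℝ}, p ≤ q → q ≤ t ^ 2 * C ^ 2 / 2 →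
          |Real.exp p - Real.exp q| ≤ Real.exp (t ^ 2 * C ^ 2 / 2) * |p - q| := by
        intro p q hpq hq
        rw [abs_of_nonpos (by linarith [Real.exp_le_exp.2 hpq]), abs_of_nonpos (by linarith)]
        have h1 := Real.add_one_le_exp (p - q)
        have h2 : Real.exp p = Real.exp q * Real.exp (p - q) := by rw [← Real.exp_add]; ring_nf
        have h3 := Real.exp_le_exp.2 hq
        have h4 := Real.exp_pos q
        nlinarith
      intro y
      have hval : |t ^ 2 * s2 / 2 - t ^ 2 * V y / 2| = t ^ 2 / 2 * |V y - s2| := by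
        rw [show t ^ 2 * s2 / 2 - t ^ 2 * V y / 2 = t ^ 2 / 2 * (s2 - V y) by ring, abs_mul,
          abs_of_nonneg (by positivity), abs_sub_comm]
      rw [mul_assoc, ← hval]
      have ht : 0 ≤ t ^ 2 := sq_nonneg t
      rcases le_total s2 (V y) with h | h
      · exact haux (by gcongr) (by gcongr; exact hV1 y)
      · rw [abs_sub_comm, abs_sub_comm (t ^ 2 * s2 / 2)]
        exact haux (by gcongr) (by gcongr)
    have hVint : ∫ y, |V y - s2| ∂iidLaw ν ≤ (9 * C ^ 4 + 1) / 2 / √n := by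
      have hV2 : Integrable (fun y => (V y - s2) ^ 2) (iidLaw ν) :=
        integrable_of_abs_le ((hVm.sub_const _).pow_const 2) (C := (C ^ 2) ^ 2) fun y => by
          rw [abs_pow]
          refine pow_le_pow_left₀ (abs_nonneg _) (abs_le.2 ?_) 2
          constructor <;> linarith [hV0 y, hV1 y]
      -- The weights √n/2 and 1/(2√n) in 2|x| ≤ √n x² + 1/√n balance the variance bound of order
      -- 1/n, giving the rate 1/√n.
      have hle : ∫ y, |V y - s2| ∂iidLaw ν
          ≤ ∫ y, (√n / 2 * (V y - s2) ^ 2 + 1 / (2 * √n)) ∂iidLaw ν := by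
        refine integral_mono_of_nonneg (ae_of_all _ fun y => abs_nonneg _)
          ((hV2.const_mul _).add (integrable_const _)) (ae_of_all _ fun y => ?_)
        simp only
        rw [← sq_abs (V y - s2)]
        have : √(n : ℝ) / 2 * |V y - s2| ^ 2 + 1 / (2 * √n) - |V y - s2|
            = (√n * |V y - s2| - 1) ^ 2 / (2 * √n) := by field_simp; ring
        have h0 : 0 ≤ (√n * |V y - s2| - 1) ^ 2 / (2 * √n) := by positivity
        linarith
      rw [integral_add (hV2.const_mul _) (integrable_const _), integral_const_mul,
        integral_const, probReal_univ, one_smul] at hle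
      refine hle.trans ?_
      have h9 := hψ.integral_sq_sub_kernelVar_le hn
      calc _ ≤ √n / 2 * (9 * C ^ 4 / n) + 1 / (2 * √n) := by gcongr
        _ = (9 * C ^ 4 + 1) / 2 / √n := by
          nth_rewrite 2 [← hss]
          field_simp
    have hnormS : ∀ y, ‖Complex.exp ((S y : ℂ) * Complex.I)‖ = 1 := fun y =>
      Complex.norm_exp_ofReal_mul_I _
    have hpt : ∀ y, ‖Complex.exp ((S y : ℂ) * Complex.I)
          * Complex.exp ((t ^ 2 * s2 / 2 : ℝ) : ℂ) - T y‖
        ≤ 30 * (|t| * C) ^ 3 * Real.exp (t ^ 2 * C ^ 2 / 2) / √n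
          + Real.exp (t ^ 2 * C ^ 2 / 2) * (t ^ 2 / 2) * |V y - s2| := by
      intro y
      have hdec : Complex.exp ((S y : ℂ) * Complex.I) * Complex.exp ((t ^ 2 * s2 / 2 : ℝ) : ℂ)
          - T y = (Complex.exp (S y * Complex.I + (t ^ 2 * V y / 2 : ℝ)) - T y)
            + Complex.exp ((S y : ℂ) * Complex.I)
              * ((Real.exp (t ^ 2 * s2 / 2) - Real.exp (t ^ 2 * V y / 2) : ℝ) : ℂ) := by
        rw [Complex.exp_add]
        push_cast
        ring
      rw [hdec]
      refine (norm_add_le _ _).trans (add_le_add (hST y) ?_)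
      rw [norm_mul, hnormS, one_mul, Complex.norm_real]
      exact hexp y
    have hSc : Measurable fun y => Complex.exp ((S y : ℂ) * Complex.I) :=
      Complex.measurable_exp.comp ((Complex.measurable_ofReal.comp hSm).mul_const _)
    have hSi : Integrable (fun y => Complex.exp ((S y : ℂ) * Complex.I)) (iidLaw ν) :=
      Integrable.of_bound hSc.aestronglyMeasurable 1 (ae_of_all _ fun y => (hnormS y).le)
    -- A non-integrable function has Bochner integral 0, whereas that of `T` is 1.
    have hTi : Integrable T (iidLaw ν) := by
      by_contra hT
      have h0 := integral_undef hT
      rw [hψ.integral_prod_eq_one] at h0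
      exact one_ne_zero h0
    have hone : ∫ y, T y ∂iidLaw ν = 1 := hψ.integral_prod_eq_one _ _
    rw [← hone, ← integral_mul_const, ← integral_sub (hSi.mul_const _) hTi]
    have hVi : Integrable (fun y => |V y - s2|) (iidLaw ν) :=
      (integrable_of_abs_le (hVm.sub_const _) (C := C ^ 2) fun y => by
        rw [abs_le]; constructor <;> linarith [hV0 y, hV1 y]).abs
    refine (norm_integral_le_integral_norm _).trans ?_
    refine (integral_mono_of_nonneg (ae_of_all _ fun y => norm_nonneg _)
      ((integrable_const _).add (hVi.const_mul _)) (ae_of_all _ hpt)).trans ?_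
    simp only [Pi.add_apply]
    rw [integral_add (integrable_const _) (hVi.const_mul _), integral_const_mul, integral_const,
      probReal_univ, one_smul]
    calc _ ≤ 30 * (|t| * C) ^ 3 * Real.exp (t ^ 2 * C ^ 2 / 2) / √n
          + Real.exp (t ^ 2 * C ^ 2 / 2) * (t ^ 2 / 2) * ((9 * C ^ 4 + 1) / 2 / √n) := by gcongr
      _ = R / √n := by simp only [R]; ring
  have hR : Tendsto (fun n : ℕ => R / √(n : ℝ)) atTop (𝓝 0) :=
    Tendsto.const_div_atTop (Real.tendsto_sqrt_atTop.comp tendsto_natCast_atTop_atTop) R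
  have h1 := (squeeze_zero_norm' hbound hR).add_const 1
  have h2 := h1.mul_const (Complex.exp ((-(t ^ 2 * s2 / 2) : ℝ) : ℂ))
  rw [zero_add, one_mul] at h2
  refine h2.congr fun n => ?_
  rw [sub_add_cancel, mul_assoc, ← Complex.exp_add]
  push_cast
  rw [add_neg_cancel, Complex.exp_zero, mul_one]

/-- Central limit theorem for a degenerate kernel along the path `0, 1, 2, …`. -/
theorem tendstoInDistribution (hψ : DegenerateKernel ν ψ C) :
    TendstoInDistribution (fun (n : ℕ) (y : ℕ → ℝ) =>
        (√(n : ℝ))⁻¹ * ∑ i ∈ Finset.range (n - 1), ψ (y i) (y (i + 1))) atTop (fun z : ℝ => z)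
      (fun _ => iidLaw ν) (gaussianReal 0 (kernelVar ν ψ).toNNReal) := by
  have hm : ∀ n : ℕ, Measurable fun y : ℕ → ℝ =>
      (√(n : ℝ))⁻¹ * ∑ i ∈ Finset.range (n - 1), ψ (y i) (y (i + 1)) := fun n =>
    (Finset.measurable_fun_sum _ fun i _ => hψ.measurable_pair i (i + 1)).const_mul _
  refine ⟨fun n => (hm n).aemeasurable, aemeasurable_id, ?_⟩
  refine ProbabilityMeasure.tendsto_of_tendsto_charFun fun t => ?_
  have hlim : charFun (Measure.map (fun z : ℝ => z) (gaussianReal 0 (kernelVar ν ψ).toNNReal)) t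
      = Complex.exp ((-(t ^ 2 * kernelVar ν ψ / 2) : ℝ) : ℂ) := by
    rw [Measure.map_id', charFun_gaussianReal, Real.coe_toNNReal _ (kernelVar_nonneg ψ)]
    congr 1
    push_cast
    ring
  simp only [ProbabilityMeasure.coe_mk]
  rw [hlim]
  refine (hψ.tendsto_charFun t).congr fun n => ?_
  rw [charFun_apply_real, integral_map (hm n).aemeasurable (by fun_prop)]
  refine integral_congr_ae (ae_of_all _ fun y => ?_)
  simp only
  congr 1
  push_cast
  ring

end DegenerateKernel

end RankCorr

end

/-! ### Decomposition of the statistics and the limit theorem in natural order. -/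

noncomputable section

namespace RankCorr

section BddMeasurable

variable {S : Type*} [MeasurableSpace S]

/-- A bounded measurable real function. -/
structure BddMeasurable (f : S → ℝ) : Prop where
  measurable : Measurable f
  bounded : ∃ C, ∀ s, |f s| ≤ C

namespace BddMeasurable

variable {f g : S → ℝ}

lemma const (c : ℝ) : BddMeasurable fun _ : S => c := ⟨measurable_const, |c|, fun _ => le_rfl⟩

lemma add (hf : BddMeasurable f) (hg : BddMeasurable g) : BddMeasurable fun s => f s + g s := by
  obtain ⟨C, hC⟩ := hf.bounded
  obtain ⟨D, hD⟩ := hg.bounded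
  exact ⟨hf.measurable.add hg.measurable, C + D, fun s =>
    (abs_add_le _ _).trans (add_le_add (hC s) (hD s))⟩

lemma const_mul (hf : BddMeasurable f) (c : ℝ) : BddMeasurable fun s => c * f s := by
  obtain ⟨C, hC⟩ := hf.bounded
  exact ⟨hf.measurable.const_mul c, |c| * C, fun s => by
    rw [abs_mul]; exact mul_le_mul_of_nonneg_left (hC s) (abs_nonneg _)⟩

lemma sub (hf : BddMeasurable f) (hg : BddMeasurable g) : BddMeasurable fun s => f s - g s := by
  simpa [sub_eq_add_neg] using hf.add (hg.const_mul (-1))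

lemma sum {ι : Type*} (t : Finset ι) {f : ι → S → ℝ} (hf : ∀ i, BddMeasurable (f i)) :
    BddMeasurable fun s => ∑ i ∈ t, f i s := by
  classical
  induction t using Finset.induction_on with
  | empty => simpa using const 0
  | insert i t hi ih => simpa [Finset.sum_insert hi] using (hf i).add ih

lemma integrable_sq {P : Measure S} [IsProbabilityMeasure P] (hf : BddMeasurable f) :
    Integrable (fun s => f s ^ 2) P := by
  obtain ⟨C, hC⟩ := hf.bounded
  exact integrable_of_abs_le (hf.measurable.pow_const 2) (C := C ^ 2) fun s => by
    rw [abs_pow]; exact pow_le_pow_left₀ (abs_nonneg _) (hC s) 2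

lemma contrast {a : S → ℕ → ℕ → ℝ} (ha : ∀ i j, BddMeasurable fun s => a s i j) (n : ℕ) :
    BddMeasurable fun s => RankCorr.contrast n (a s) :=
  (sum _ fun i => ha i (i + 1)).sub ((sum _ fun i => sum _ fun j => ha i j).const_mul _)

end BddMeasurable

variable {P : Measure S} [IsProbabilityMeasure P]

lemma integral_sq_add_three_le {f g h : S → ℝ} (hf : BddMeasurable f) (hg : BddMeasurable g)
    (hh : BddMeasurable h) : ∫ s, (f s + g s + h s) ^ 2 ∂P
      ≤ 3 * (∫ s, f s ^ 2 ∂P + ∫ s, g s ^ 2 ∂P + ∫ s, h s ^ 2 ∂P) := by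
  have hf2 := hf.integrable_sq (P := P)
  have hg2 := hg.integrable_sq (P := P)
  have hh2 := hh.integrable_sq (P := P)
  rw [← integral_add hf2 hg2, ← integral_add (f := fun s => f s ^ 2 + g s ^ 2) (hf2.add hg2) hh2,
    ← integral_const_mul]
  refine integral_mono_of_nonneg (ae_of_all _ fun s => sq_nonneg _)
    (((hf2.add hg2).add hh2).const_mul 3) (ae_of_all _ fun s => ?_)
  simp only
  nlinarith [sq_nonneg (f s - g s), sq_nonneg (f s - h s), sq_nonneg (g s - h s)]

lemma integral_sq_const_mul (c : ℝ) (f : S → ℝ) :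
    ∫ s, (c * f s) ^ 2 ∂P = c ^ 2 * ∫ s, f s ^ 2 ∂P := by
  simp_rw [mul_pow]
  rw [integral_const_mul]

/-- Convergence in probability of a sum of three terms with vanishing second moments. -/
lemma tendstoInMeasure_add_three {f g h : ℕ → S → ℝ} (hf : ∀ n, BddMeasurable (f n))
    (hg : ∀ n, BddMeasurable (g n)) (hh : ∀ n, BddMeasurable (h n)) {a b c : ℝ}
    (ha : ∀ n : ℕ, 0 < n → ∫ s, f n s ^ 2 ∂P ≤ a / n)
    (hb : ∀ n : ℕ, 0 < n → ∫ s, g n s ^ 2 ∂P ≤ b / n)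
    (hc : ∀ n : ℕ, 0 < n → ∫ s, h n s ^ 2 ∂P ≤ c / n) :
    TendstoInMeasure P (fun n s => f n s + g n s + h n s) atTop fun _ => 0 := by
  refine tendstoInMeasure_of_integral_sq_le (c := fun n : ℕ => 3 * (a + b + c) / n)
    (fun n => (((hf n).add (hg n)).add (hh n)).measurable)
    (fun n => (((hf n).add (hg n)).add (hh n)).bounded)
    (tendsto_const_div_atTop_nhds_zero_nat _) ?_
  filter_upwards [eventually_gt_atTop 0] with n hn
  refine (integral_sq_add_three_le (hf n) (hg n) (hh n)).trans ?_
  have := ha n hn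
  have := hb n hn
  have := hc n hn
  rw [mul_div_assoc, add_div, add_div]
  linarith

end BddMeasurable

variable {ν : Measure ℝ} [IsProbabilityMeasure ν]

/-- The kernel evaluated at the normalized ranks. -/
def rankKernel (k : ℝ → ℝ → ℝ) (n : ℕ) (y : ℕ → ℝ) (i j : ℕ) : ℝ :=
  k (empCdf n y (y i)) (empCdf n y (y j))

/-- The variation statistic of the first `n` terms of a sequence, in their natural order. -/
def seqVariation (k : ℝ → ℝ → ℝ) (n : ℕ) (y : ℕ → ℝ) : ℝ :=
  (1 / (n : ℝ)) * ∑ i ∈ Finset.range (n - 1), rankKernel k n y i (i + 1)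

/-- The normalization statistic of the first `n` terms of a sequence. -/
def seqNormalization (k : ℝ → ℝ → ℝ) (n : ℕ) (y : ℕ → ℝ) : ℝ :=
  (1 / (n : ℝ) ^ 2) * ∑ i ∈ Finset.range n, ∑ j ∈ Finset.range n, rankKernel k n y i j

open Classical in
/-- The rank-based correlation coefficient of the first `n` terms of a sequence. -/
def seqCoeff (k : ℝ → ℝ → ℝ) (n : ℕ) (y : ℕ → ℝ) : ℝ :=
  if seqNormalization k n y = 0 then 1
  else 1 - seqVariation k n y / seqNormalization k n y

/-- The path visits every interior index twice and the two endpoints once, so almost all of an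
additive array cancels against its mean. -/
lemma contrast_additive {n : ℕ} (hn : 0 < n) (g : ℕ → ℝ) (c : ℝ) :
    contrast n (fun i j => g i + g j - c) = c - g 0 - g (n - 1) := by
  obtain ⟨m, rfl⟩ : ∃ m, n = m + 1 := ⟨n - 1, by omega⟩
  simp only [contrast, Nat.add_sub_cancel, Finset.sum_sub_distrib, Finset.sum_add_distrib,
    Finset.sum_const, Finset.card_range, nsmul_eq_mul, ← Finset.mul_sum]
  have h1 := Finset.sum_range_succ g m
  have h2 := Finset.sum_range_succ' g m
  have h3 : ((m + 1 : ℕ) : ℝ) ≠ 0 := by positivity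
  have h4 : ∑ i ∈ Finset.range m, g i = ∑ i ∈ Finset.range (m + 1), g i - g m := by linarith
  have h5 : ∑ i ∈ Finset.range m, g (i + 1) = ∑ i ∈ Finset.range (m + 1), g i - g 0 := by linarith
  rw [h4, h5]
  field_simp
  push_cast
  ring

namespace LipKernel

variable {k : ℝ → ℝ → ℝ} {K M : ℝ}

/-- The kernel composed with the distribution function. -/
def _root_.RankCorr.cdfKernel (ν : Measure ℝ) (k : ℝ → ℝ → ℝ) (u v : ℝ) : ℝ :=
  k (cdf ν u) (cdf ν v)

lemma boundedKernel (hk : LipKernel k K M) : BoundedKernel (cdfKernel ν k) M :=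
  hk.boundedKernel_comp (monotone_cdf ν).measurable

lemma bddMeasurable_kernelError (hk : LipKernel k K M) (n i j : ℕ) :
    BddMeasurable fun y => kernelError ν k n y i j :=
  ⟨hk.measurable_kernelError n i j, 2 * M, fun y => hk.abs_kernelError_le n y i j⟩

lemma bddMeasurable_rankKernel (hk : LipKernel k K M) (n i j : ℕ) :
    BddMeasurable fun y => rankKernel k n y i j :=
  ⟨hk.measurable_comp (measurable_empCdf n i) (measurable_empCdf n j), M,
    fun _ => hk.bound _ _⟩

end LipKernel

lemma DegenerateKernel.bddMeasurable_pair {ψ : ℝ → ℝ → ℝ} {C : ℝ} (hψ : DegenerateKernel ν ψ C)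
    (i j : ℕ) : BddMeasurable fun y : ℕ → ℝ => ψ (y i) (y j) :=
  ⟨hψ.measurable_pair i j, C, fun _ => hψ.bound _ _⟩

lemma BoundedKernel.bddMeasurable_integral {f : ℝ → ℝ → ℝ} {M : ℝ} (hf : BoundedKernel f M)
    (i : ℕ) : BddMeasurable fun y : ℕ → ℝ => ∫ v, f (y i) v ∂ν :=
  ⟨hf.measurable_integral.comp (measurable_pi_apply i), M, fun y => hf.abs_integral_le (y i)⟩

/-- Plug-in error, additive projection and degenerate part; only the last one contributes to the
limit of the contrast. -/
lemma rankKernel_eq (ν : Measure ℝ) (k : ℝ → ℝ → ℝ) (n : ℕ) (y : ℕ → ℝ) (i j : ℕ) :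
    rankKernel k n y i j = kernelError ν k n y i j
      + ((∫ v, cdfKernel ν k (y i) v ∂ν) + (∫ v, cdfKernel ν k (y j) v ∂ν)
        - kernelMean ν (cdfKernel ν k))
      + degeneratePart ν (cdfKernel ν k) (y i) (y j) := by
  rw [rankKernel, kernelError, degeneratePart, cdfKernel]
  ring

namespace LipKernel

variable {k : ℝ → ℝ → ℝ} {K M : ℝ}

lemma bddMeasurable_seqNormalization (hk : LipKernel k K M) (n : ℕ) :
    BddMeasurable (seqNormalization k n) :=
  (BddMeasurable.sum _ fun i => BddMeasurable.sum _ fun j =>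
    hk.bddMeasurable_rankKernel n i j).const_mul _

/-- An average has mean square at most that of its terms; consistency needs no cancellation here. -/
lemma integral_sq_mean_kernelError_le (hk : LipKernel k K M) {n : ℕ} (hn : 0 < n) :
    ∫ y, (1 / (n : ℝ) ^ 2 * ∑ p ∈ Finset.range n ×ˢ Finset.range n,
      kernelError ν k n y p.1 p.2) ^ 2 ∂iidLaw ν ≤ 8 * K ^ 2 / n := by
  have hn' : (0 : ℝ) < n := by exact_mod_cast hn
  have hM : 0 ≤ M := (abs_nonneg _).trans (hk.bound 0 0)
  have hsum := integral_sq_sum_le (P := iidLaw ν) (Finset.range n ×ˢ Finset.range n)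
    (f := fun p y => kernelError ν k n y p.1 p.2) (C := 2 * M)
    (c := fun _ _ => 8 * K ^ 2 / n)
    (fun p _ => hk.measurable_kernelError n p.1 p.2)
    (fun p _ y => hk.abs_kernelError_le n y p.1 p.2) fun p _ q _ => ?_
  · rw [integral_sq_const_mul]
    simp only [Finset.sum_const, Finset.card_product, Finset.card_range, nsmul_eq_mul,
      Nat.cast_mul] at hsum
    calc _ ≤ (1 / (n : ℝ) ^ 2) ^ 2 * (n * n * (n * n * (8 * K ^ 2 / n))) := by gcongr
      _ = 8 * K ^ 2 / n := by field_simp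
  · have hp := (hk.bddMeasurable_kernelError (ν := ν) n p.1 p.2).integrable_sq (P := iidLaw ν)
    have hq := (hk.bddMeasurable_kernelError (ν := ν) n q.1 q.2).integrable_sq (P := iidLaw ν)
    have hle : ∫ y, kernelError ν k n y p.1 p.2 * kernelError ν k n y q.1 q.2 ∂iidLaw ν
        ≤ ∫ y, (1 / 2 * kernelError ν k n y p.1 p.2 ^ 2
          + 1 / 2 * kernelError ν k n y q.1 q.2 ^ 2) ∂iidLaw ν := by
      refine integral_mono (integrable_of_abs_le ((hk.measurable_kernelError n p.1 p.2).mul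
        (hk.measurable_kernelError n q.1 q.2)) (C := 2 * M * (2 * M)) fun y => ?_)
        ((hp.const_mul _).add (hq.const_mul _)) fun y => ?_
      · rw [abs_mul]
        exact mul_le_mul (hk.abs_kernelError_le n y p.1 p.2) (hk.abs_kernelError_le n y q.1 q.2)
          (abs_nonneg _) (by linarith)
      · simp only
        nlinarith [sq_nonneg (kernelError ν k n y p.1 p.2 - kernelError ν k n y q.1 q.2)]
    rw [integral_add (hp.const_mul _) (hq.const_mul _), integral_const_mul,
      integral_const_mul] at hle
    linarith [hk.integral_sq_kernelError_le (ν := ν) hn p.1 p.2,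
      hk.integral_sq_kernelError_le (ν := ν) hn q.1 q.2]

lemma _root_.RankCorr.BoundedKernel.integral_sq_mean_integral_le {f : ℝ → ℝ → ℝ}
    (hf : BoundedKernel f M) {n : ℕ} (hn : 0 < n) :
    ∫ y, (2 / (n : ℝ) * ∑ i ∈ Finset.range n, (∫ v, f (y i) v ∂ν - kernelMean ν f)) ^ 2 ∂iidLaw ν
      ≤ 4 * (2 * M) ^ 2 / n := by
  have hM := hf.nonneg
  have hn' : (0 : ℝ) < n := by exact_mod_cast hn
  have hθ := abs_le.1 (hf.abs_kernelMean_le (ν := ν))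
  have hb : ∀ (i : ℕ) (y : ℕ → ℝ), |∫ v, f (y i) v ∂ν - kernelMean ν f| ≤ 2 * M := fun i y => by
    have := abs_le.1 (hf.abs_integral_le (ν := ν) (y i))
    rw [abs_le]
    constructor <;> linarith [hθ.1, hθ.2, this.1, this.2]
  have hm : ∀ i : ℕ, Measurable fun y : ℕ → ℝ => ∫ v, f (y i) v ∂ν - kernelMean ν f := fun i =>
    (hf.bddMeasurable_integral i).measurable.sub_const _
  have hsum := integral_sq_sum_le_of_orthogonal (P := iidLaw ν) (n := n)
    (f := fun i y => ∫ v, f (y i) v ∂ν - kernelMean ν f) hm hb fun i j hij => by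
      refine integral_iidLaw_eq_zero (integrable_of_abs_le ((hm i).mul (hm j))
        (C := 2 * M * (2 * M)) fun y => ?_) j fun y => ?_
      · rw [abs_mul]
        exact mul_le_mul (hb i y) (hb j y) (abs_nonneg _) (by linarith)
      · simp only [Function.update_self, Function.update_of_ne hij.ne]
        rw [integral_const_mul, integral_sub hf.integrable_integral (integrable_const _)]
        simp [kernelMean]
  rw [integral_sq_const_mul]
  calc _ ≤ (2 / (n : ℝ)) ^ 2 * (n * (2 * M) ^ 2) := by gcongr
    _ = 4 * (2 * M) ^ 2 / n := by field_simp; ring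

-- The Hoeffding decomposition of the V-statistic, with the plug-in error added; for a probability
-- law and a `LipKernel`, each of the three terms has a second moment of order at most 1/n.
omit [IsProbabilityMeasure ν] in
lemma _root_.RankCorr.seqNormalization_sub_eq (k : ℝ → ℝ → ℝ) {n : ℕ} (hn : 0 < n) (y : ℕ → ℝ) :
    seqNormalization k n y - kernelMean ν (cdfKernel ν k)
      = 1 / (n : ℝ) ^ 2 *
          ∑ p ∈ Finset.range n ×ˢ Finset.range n, kernelError ν k n y p.1 p.2
        + 2 / (n : ℝ) * ∑ i ∈ Finset.range n,
          (∫ v, cdfKernel ν k (y i) v ∂ν - kernelMean ν (cdfKernel ν k))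
        + 1 / (n : ℝ) ^ 2 * ∑ i ∈ Finset.range n, ∑ j ∈ Finset.range n,
          degeneratePart ν (cdfKernel ν k) (y i) (y j) := by
  have hn' : (n : ℝ) ≠ 0 := by exact_mod_cast hn.ne'
  rw [seqNormalization, Finset.sum_product]
  simp only [rankKernel_eq ν k n y, Finset.sum_add_distrib, Finset.sum_sub_distrib,
    Finset.sum_const, Finset.card_range, nsmul_eq_mul, ← Finset.mul_sum]
  generalize ∑ i ∈ Finset.range n, ∑ j ∈ Finset.range n, kernelError ν k n y i j = a
  generalize ∑ i ∈ Finset.range n, ∫ v, cdfKernel ν k (y i) v ∂ν = b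
  generalize ∑ i ∈ Finset.range n, ∑ j ∈ Finset.range n,
    degeneratePart ν (cdfKernel ν k) (y i) (y j) = c
  field_simp
  ring

/-- The normalization statistic is consistent. -/
lemma tendstoInMeasure_seqNormalization (hk : LipKernel k K M) :
    TendstoInMeasure (iidLaw ν) (seqNormalization k) atTop
      fun _ => kernelMean ν (cdfKernel ν k) := by
  have hf : BoundedKernel (cdfKernel ν k) M := hk.boundedKernel
  have hψ := hf.degenerateKernel (ν := ν)
  have h := tendstoInMeasure_add_three (P := iidLaw ν)
    (fun n => (BddMeasurable.sum (Finset.range n ×ˢ Finset.range n) fun p =>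
      hk.bddMeasurable_kernelError (ν := ν) n p.1 p.2).const_mul (1 / (n : ℝ) ^ 2))
    (fun n => (BddMeasurable.sum (Finset.range n) fun i => (hf.bddMeasurable_integral (ν := ν)
      i).sub (BddMeasurable.const (kernelMean ν (cdfKernel ν k)))).const_mul (2 / (n : ℝ)))
    (fun n => (BddMeasurable.sum (Finset.range n) fun i => BddMeasurable.sum (Finset.range n)
      fun j => hψ.bddMeasurable_pair i j).const_mul (1 / (n : ℝ) ^ 2))
    (fun n hn => hk.integral_sq_mean_kernelError_le hn)
    (fun n hn => hf.integral_sq_mean_integral_le hn) (c := 3 * (4 * M) ^ 2) fun n hn => ?_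
  · rw [tendstoInMeasure_iff_norm] at h ⊢
    intro ε hε
    refine (h ε hε).congr' ?_
    filter_upwards [eventually_gt_atTop 0] with n hn
    simp only [seqNormalization_sub_eq (ν := ν) k hn, sub_zero]
  · have hn' : (1 : ℝ) ≤ n := by exact_mod_cast hn
    rw [integral_sq_const_mul]
    calc _ ≤ (1 / (n : ℝ) ^ 2) ^ 2 * (3 * n ^ 2 * (4 * M) ^ 2) := by
          gcongr; exact hψ.integral_sq_double_sum_le n
      _ = 3 * (4 * M) ^ 2 / n ^ 2 := by field_simp
      _ ≤ 3 * (4 * M) ^ 2 / n := by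
          gcongr
          nlinarith

/-- Central limit theorem for the centred variation statistic. -/
lemma tendstoInDistribution_contrast (hk : LipKernel k K M) :
    TendstoInDistribution (fun (n : ℕ) (y : ℕ → ℝ) =>
        (√(n : ℝ))⁻¹ * contrast n (rankKernel k n y)) atTop (fun z : ℝ => z)
      (fun _ => iidLaw ν)
      (gaussianReal 0 (kernelVar ν (degeneratePart ν (cdfKernel ν k))).toNNReal) := by
  set f := cdfKernel ν k
  set θ := kernelMean ν f
  have hf : BoundedKernel f M := hk.boundedKernel
  have hψ : DegenerateKernel ν (degeneratePart ν f) (4 * M) := hf.degenerateKernel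
  have hM := hf.nonneg
  have hθ := abs_le.1 (hf.abs_kernelMean_le (ν := ν))
  refine tendstoInDistribution_of_tendstoInMeasure_sub _ _ hψ.tendstoInDistribution ?_ fun n =>
    ((BddMeasurable.contrast (hk.bddMeasurable_rankKernel n) n).const_mul _).measurable.aemeasurable
  have hadd : ∀ i j, BddMeasurable fun y : ℕ → ℝ =>
      (∫ v, f (y i) v ∂ν) + (∫ v, f (y j) v ∂ν) - θ := fun i j =>
    ((hf.bddMeasurable_integral i).add (hf.bddMeasurable_integral j)).sub (BddMeasurable.const θ)
  -- The difference from the path sum of ψ: the contrast of the plug-in error, the boundary terms of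
  -- the additive part, and the centring of the degenerate part. Before division by √n each is O(1)
  -- in mean square.
  have h := tendstoInMeasure_add_three (P := iidLaw ν)
    (f := fun n y => (√(n : ℝ))⁻¹ * contrast n (kernelError ν k n y))
    (g := fun n y => (√(n : ℝ))⁻¹ * contrast n
      (fun i j => (∫ v, f (y i) v ∂ν) + (∫ v, f (y j) v ∂ν) - θ))
    (h := fun n y => (-(√(n : ℝ))⁻¹ * (1 / n)) *
      ∑ i ∈ Finset.range n, ∑ j ∈ Finset.range n, degeneratePart ν f (y i) (y j))
    (a := 464 * K ^ 2) (b := (3 * M) ^ 2) (c := 3 * (4 * M) ^ 2)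
    (fun n => (BddMeasurable.contrast (hk.bddMeasurable_kernelError n) n).const_mul _)
    (fun n => (BddMeasurable.contrast hadd n).const_mul _)
    (fun n => (BddMeasurable.sum _ fun i => BddMeasurable.sum _ fun j =>
      hψ.bddMeasurable_pair i j).const_mul _) ?_ ?_ ?_
  · refine h.congr (fun n => ae_of_all _ fun y => ?_) (ae_of_all _ fun y => rfl)
    simp only [Pi.sub_apply]
    have heq : contrast n (rankKernel k n y) = contrast n (kernelError ν k n y)
        + contrast n (fun i j => (∫ v, f (y i) v ∂ν) + (∫ v, f (y j) v ∂ν) - θ)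
        + contrast n (fun i j => degeneratePart ν f (y i) (y j)) := by
      rw [← contrast_add, ← contrast_add]
      congr 1
      funext i j
      exact rankKernel_eq ν k n y i j
    have hc : contrast n (fun i j => degeneratePart ν f (y i) (y j))
        = ∑ i ∈ Finset.range (n - 1), degeneratePart ν f (y i) (y (i + 1)) - (1 / (n : ℝ)) *
          ∑ i ∈ Finset.range n, ∑ j ∈ Finset.range n, degeneratePart ν f (y i) (y j) := rfl
    rw [heq, hc]
    ring
  all_goals
    intro n hn
    have hn' : (0 : ℝ) < n := by exact_mod_cast hn
    have hsq : (√(n : ℝ))⁻¹ ^ 2 = 1 / n := by rw [inv_pow, Real.sq_sqrt hn'.le, one_div]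
  · rw [integral_sq_const_mul, hsq, one_div_mul_eq_div]
    gcongr
    exact hk.integral_sq_contrast_kernelError_le hn
  · rw [integral_sq_const_mul, hsq, one_div_mul_eq_div]
    gcongr
    refine (le_abs_self _).trans (abs_integral_le fun y => ?_)
    have h1 := abs_le.1 (hf.abs_integral_le (ν := ν) (y 0))
    have h2 := abs_le.1 (hf.abs_integral_le (ν := ν) (y (n - 1)))
    rw [abs_pow, contrast_additive hn (fun i => ∫ v, f (y i) v ∂ν)]
    refine pow_le_pow_left₀ (abs_nonneg _) (abs_le.2 ?_) 2
    constructor <;> linarith [hθ.1, hθ.2, h1.1, h1.2, h2.1, h2.2]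
  · rw [integral_sq_const_mul, mul_pow, neg_sq, hsq]
    calc _ ≤ 1 / (n : ℝ) * (1 / n) ^ 2 * (3 * n ^ 2 * (4 * M) ^ 2) := by
          gcongr; exact hψ.integral_sq_double_sum_le n
      _ = 3 * (4 * M) ^ 2 / n := by field_simp

lemma measurable_seqCoeff (hk : LipKernel k K M) (n : ℕ) : Measurable (seqCoeff k n) := by
  have h1 := (hk.bddMeasurable_seqNormalization n).measurable
  have h2 : Measurable (seqVariation k n) :=
    ((BddMeasurable.sum _ fun i => hk.bddMeasurable_rankKernel n i (i + 1)).const_mul _).measurable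
  exact Measurable.ite (h1 (measurableSet_singleton 0)) measurable_const
    ((h2.div h1).const_sub 1)

/-- Central limit theorem for the rank-based coefficient of an i.i.d. sequence. -/
theorem tendstoInDistribution_seqCoeff (hk : LipKernel k K M)
    (hθ : 0 < kernelMean ν (cdfKernel ν k)) :
    TendstoInDistribution (fun (n : ℕ) (y : ℕ → ℝ) => √(n : ℝ) * seqCoeff k n y) atTop
      (fun z : ℝ => z) (fun _ => iidLaw ν)
      (gaussianReal 0 (kernelVar ν (degeneratePart ν (cdfKernel ν k))
        / kernelMean ν (cdfKernel ν k) ^ 2).toNNReal) := by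
  set θ := kernelMean ν (cdfKernel ν k)
  set s2 := kernelVar ν (degeneratePart ν (cdfKernel ν k))
  have hs2 : 0 ≤ s2 := DegenerateKernel.kernelVar_nonneg _
  have hpos : ∀ c : ℝ, 0 < max c (θ / 2) := fun c => lt_max_of_lt_right (by linarith)
  -- Truncating the denominator at θ/2 makes the quotient continuous everywhere, as Slutsky's lemma
  -- requires, without changing it near θ.
  have hg : Continuous fun p : ℝ × ℝ => -p.1 / max p.2 (θ / 2) :=
    (continuous_fst.neg).div (continuous_snd.max continuous_const) fun p => (hpos _).ne'
  have hW := hk.tendstoInDistribution_contrast (ν := ν)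
  have hχ := hk.tendstoInMeasure_seqNormalization (ν := ν)
  have hχm : ∀ n, AEMeasurable (seqNormalization k n) (iidLaw ν) := fun n =>
    (hk.bddMeasurable_seqNormalization n).measurable.aemeasurable
  have hS := hW.continuous_comp_prodMk_of_tendstoInMeasure_const hg hχ hχm
  have hlim : (gaussianReal 0 s2.toNNReal).map (fun z => -z / max θ (θ / 2))
      = (gaussianReal 0 (s2 / θ ^ 2).toNNReal).map fun z => z := by
    rw [max_eq_left (by linarith), Measure.map_id']
    have : (fun z : ℝ => -z / θ) = fun z => (-θ⁻¹) * z := by ext z; rw [div_eq_mul_inv]; ring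
    rw [this, gaussianReal_map_const_mul, mul_zero]
    congr 1
    ext
    simp only [NNReal.coe_mul, NNReal.coe_mk, Real.coe_toNNReal _ hs2,
      Real.coe_toNNReal _ (div_nonneg hs2 (sq_nonneg θ))]
    rw [neg_sq, inv_pow, div_eq_inv_mul]
  have hS' : TendstoInDistribution (fun (n : ℕ) (y : ℕ → ℝ) =>
      -((√(n : ℝ))⁻¹ * contrast n (rankKernel k n y)) / max (seqNormalization k n y) (θ / 2))
      atTop (fun z : ℝ => z) (fun _ => iidLaw ν) (gaussianReal 0 (s2 / θ ^ 2).toNNReal) := by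
    refine ⟨hS.forall_aemeasurable, aemeasurable_id, ?_⟩
    have h := hS.tendsto
    convert h using 2
    exact congrArg 𝓝 (Subtype.ext hlim.symm)
  refine tendstoInDistribution_of_tendstoInMeasure_sub _ _ hS' ?_ fun n =>
    ((hk.measurable_seqCoeff n).const_mul _).aemeasurable
  rw [tendstoInMeasure_iff_norm] at hχ ⊢
  intro ε hε
  -- When the normalization lies within θ/2 of θ, neither the truncation nor the default value 1 is
  -- active and the two expressions agree exactly; the complementary event has vanishing
  -- probability.
  refine tendsto_of_tendsto_of_tendsto_of_le_of_le' tendsto_const_nhds (hχ (θ / 2) (by linarith))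
    (Eventually.of_forall fun _ => bot_le) ?_
  filter_upwards [eventually_gt_atTop 0] with n hn
  have hn' : (0 : ℝ) < n := by exact_mod_cast hn
  refine measure_mono fun y hy => ?_
  simp only [Set.mem_ofPred_eq] at hy ⊢
  by_contra hlt
  rw [not_le, Real.norm_eq_abs, abs_lt] at hlt
  have hχ2 : θ / 2 < seqNormalization k n y := by linarith [hlt.1]
  have hχ0 : 0 < seqNormalization k n y := by linarith
  have hs : 0 < √(n : ℝ) := Real.sqrt_pos.2 hn'
  have hc : contrast n (rankKernel k n y)
      = n * (seqVariation k n y - seqNormalization k n y) := by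
    rw [contrast, seqVariation, seqNormalization]
    field_simp
  have hzero : √(n : ℝ) * seqCoeff k n y
      - -((√(n : ℝ))⁻¹ * contrast n (rankKernel k n y)) / max (seqNormalization k n y) (θ / 2)
      = 0 := by
    rw [seqCoeff, if_neg hχ0.ne', max_eq_left hχ2.le, hc]
    have hss : (n : ℝ) = √(n : ℝ) * √(n : ℝ) := (Real.mul_self_sqrt hn'.le).symm
    rw [show (√(n : ℝ))⁻¹ * ((n : ℝ) * (seqVariation k n y - seqNormalization k n y))
      = √(n : ℝ) * (seqVariation k n y - seqNormalization k n y) by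
        nth_rewrite 2 [hss]; field_simp]
    field_simp
    ring
  rw [Pi.sub_apply, Pi.sub_apply, hzero] at hy
  simp at hy
  linarith

end LipKernel

end RankCorr

end

/-! ### Positivity of the mean and of the variance; the variance formula. -/

noncomputable section

namespace RankCorr

variable {ν : Measure ℝ} [IsProbabilityMeasure ν]

/-- If q < 1, let b be the supremum of {F ≤ q}. All mass lies in (-∞, b], so F(b) = 1 ≠ q and b
carries no mass; then F(b-) = 1, while F(b-) ≤ q. -/
lemma eq_one_of_cdf_ae_eq {q : ℝ} (h : ∀ᵐ v ∂ν, cdf ν v = q) : q = 1 := by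
  obtain ⟨v, hv⟩ := h.exists
  by_contra hq
  have hq1 : q < 1 := lt_of_le_of_ne (hv ▸ cdf_le_one ν v) hq
  obtain ⟨t₀, ht₀⟩ := ((tendsto_cdf_atTop ν).eventually_const_lt hq1).exists
  set A : Set ℝ := {t | cdf ν t ≤ q}
  have hAb : BddAbove A := ⟨t₀, fun a ha => by
    by_contra hlt
    exact absurd ((monotone_cdf ν) (not_le.1 hlt).le) (not_le.2 (lt_of_le_of_lt ha ht₀))⟩
  have hAn : A.Nonempty := ⟨v, hv.le⟩
  set b := sSup A
  have hlt : ∀ t < b, cdf ν t ≤ q := fun t ht => by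
    obtain ⟨a, ha, hta⟩ := exists_lt_of_lt_csSup hAn ht
    exact ((monotone_cdf ν) hta.le).trans ha
  have hIic : cdf ν b = 1 := by
    rw [cdf_eq_real]
    have : ν (Set.Iic b) = 1 := (prob_compl_eq_zero_iff measurableSet_Iic).1
      (h.mono fun w hw => le_csSup hAb (show cdf ν w ≤ q from hw.le))
    simp [measureReal_def, this]
  have hIio : ν (Set.Iio b) = 1 := (prob_compl_eq_zero_iff measurableSet_Iio).1
    (h.mono fun w hw => lt_of_le_of_ne (le_csSup hAb (show cdf ν w ≤ q from hw.le)) (by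
      rintro rfl
      exact hq (hw.symm.trans hIic)))
  have hleft : Function.leftLim (cdf ν) b ≤ q :=
    le_of_tendsto ((monotone_cdf ν).tendsto_leftLim b)
      (eventually_nhdsWithin_of_forall fun t ht => hlt t ht)
  have hm := (cdf ν).measure_Iio (tendsto_cdf_atBot ν) b
  rw [measure_cdf, hIio, sub_zero] at hm
  have : (1 : ENNReal) < 1 := by
    calc (1 : ENNReal) = ENNReal.ofReal (Function.leftLim (cdf ν) b) := hm
      _ ≤ ENNReal.ofReal q := ENNReal.ofReal_le_ofReal hleft
      _ < 1 := by rw [← ENNReal.ofReal_one]; exact (ENNReal.ofReal_lt_ofReal_iff one_pos).2 hq1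
  exact lt_irrefl _ this

/-- A law under which its own distribution function is a.e. constant is a Dirac mass. -/
lemma exists_ae_eq_of_cdf_ae_eq {q : ℝ} (h : ∀ᵐ v ∂ν, cdf ν v = q) : ∃ c, ∀ᵐ v ∂ν, v = c := by
  have hq := eq_one_of_cdf_ae_eq h
  subst hq
  obtain ⟨w, hw⟩ := h.exists
  set B : Set ℝ := {t | cdf ν t = 1}
  obtain ⟨t₀, ht₀⟩ := ((tendsto_cdf_atBot ν).eventually_lt_const one_pos).exists
  have hBb : BddBelow B := ⟨t₀, fun a ha => by
    by_contra hlt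
    have h1 := (monotone_cdf ν) (not_le.1 hlt).le
    rw [show cdf ν a = 1 from ha] at h1
    linarith⟩
  have hBn : B.Nonempty := ⟨w, hw⟩
  -- Right continuity gives F(c) = 1, so the mass lies in (-∞, c]; and F(v) = 1 forces v ≥ c.
  set c := sInf B
  have hgt : ∀ t, c < t → cdf ν t = 1 := fun t ht => by
    obtain ⟨a, ha, hta⟩ := exists_lt_of_csInf_lt hBn ht
    exact le_antisymm (cdf_le_one ν t) ((show cdf ν a = 1 from ha) ▸ (monotone_cdf ν) hta.le)
  have hc : cdf ν c = 1 := by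
    have h1 : Tendsto (cdf ν) (𝓝[>] c) (𝓝 (cdf ν c)) :=
      ((cdf ν).right_continuous c).mono_left (nhdsWithin_mono _ Set.Ioi_subset_Ici_self)
    have h2 : Tendsto (cdf ν) (𝓝[>] c) (𝓝 1) :=
      tendsto_const_nhds.congr' (eventually_nhdsWithin_of_forall fun t ht => (hgt t ht).symm)
    exact tendsto_nhds_unique h1 h2
  have hle : ∀ᵐ v ∂ν, v ≤ c := by
    rw [cdf_eq_real, measureReal_def, ENNReal.toReal_eq_one_iff] at hc
    exact (prob_compl_eq_zero_iff measurableSet_Iic).2 hc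
  refine ⟨c, ?_⟩
  filter_upwards [h, hle] with v h1 h2
  exact le_antisymm h2 (csInf_le hBb h1)

/-- A jointly continuous function vanishing almost everywhere off the diagonal vanishes almost
everywhere on the diagonal. -/
lemma ae_diag_eq_zero {D : ℝ → ℝ → ℝ} (hD : Continuous fun p : ℝ × ℝ => D p.1 p.2) {F : ℝ → ℝ}
    (hF : Measurable F) (h : ∀ᵐ u ∂ν, ∀ᵐ v ∂ν, D (F u) (F v) = 0) :
    ∀ᵐ u ∂ν, D (F u) (F u) = 0 := by
  have hsupp : ∀ᵐ u ∂ν, F u ∈ (ν.map F).support :=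
    ae_of_ae_map hF.aemeasurable Measure.support_mem_ae
  filter_upwards [hsupp] with u hu
  by_contra hne
  have hnhds : {p : ℝ × ℝ | D p.1 p.2 ≠ 0} ∈ 𝓝 (F u, F u) :=
    (hD.continuousAt (x := (F u, F u))).eventually_ne hne
  rw [nhds_prod_eq, mem_prod_same_iff] at hnhds
  obtain ⟨U', hU', hsub⟩ := hnhds
  obtain ⟨U, hUU', hUo, huU⟩ := mem_nhds_iff.1 hU'
  have hpos : ν (F ⁻¹' U) ≠ 0 := by
    rw [← Measure.map_apply hF hUo.measurableSet]
    exact (Measure.mem_support_iff_forall _ |>.1 hu U (hUo.mem_nhds huU)).ne'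
  -- `D` has no zero on U × U, yet U has positive mass under the law of `F`, so a pair in U × U at
  -- which `D` vanishes can be picked one coordinate at a time.
  have hfreq : ∃ᶠ w in ae ν, F w ∈ U := frequently_ae_mem_iff.2 hpos
  obtain ⟨w, hw, hwU⟩ := (h.and_frequently hfreq).exists
  obtain ⟨z, hz, hzU⟩ := (hw.and_frequently hfreq).exists
  exact hsub (Set.mk_mem_prod (hUU' hwU) (hUU' hzU)) hz

namespace BddMeasurable

variable {S : Type*} [MeasurableSpace S] {f g : S → ℝ}

lemma mul (hf : BddMeasurable f) (hg : BddMeasurable g) : BddMeasurable fun s => f s * g s := by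
  obtain ⟨C, hC⟩ := hf.bounded
  obtain ⟨D, hD⟩ := hg.bounded
  exact ⟨hf.measurable.mul hg.measurable, C * D, fun s => by
    rw [abs_mul]
    exact mul_le_mul (hC s) (hD s) (abs_nonneg _) ((abs_nonneg _).trans (hC s))⟩

lemma integrable (hf : BddMeasurable f) {P : Measure S} [IsProbabilityMeasure P] :
    Integrable f P := by
  obtain ⟨C, hC⟩ := hf.bounded
  exact integrable_of_abs_le hf.measurable hC

end BddMeasurable

namespace BoundedKernel

variable {f : ℝ → ℝ → ℝ} {M : ℝ}

omit [IsProbabilityMeasure ν] in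
lemma bddMeasurable (hf : BoundedKernel f M) : BddMeasurable fun p : ℝ × ℝ => f p.1 p.2 :=
  ⟨hf.measurable, M, fun _ => hf.bound _ _⟩

lemma kernelMean_eq (hf : BoundedKernel f M) :
    kernelMean ν f = ∫ p : ℝ × ℝ, f p.1 p.2 ∂ν.prod ν :=
  (integral_prod _ hf.bddMeasurable.integrable).symm

lemma integral_mul_left (hf : BoundedKernel f M) {g : ℝ → ℝ} (hg : BddMeasurable g) :
    ∫ p : ℝ × ℝ, f p.1 p.2 * g p.1 ∂ν.prod ν = ∫ u, (∫ v, f u v ∂ν) * g u ∂ν := by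
  have hgp : BddMeasurable fun p : ℝ × ℝ => g p.1 :=
    ⟨hg.measurable.comp measurable_fst, hg.bounded.imp fun C hC p => hC p.1⟩
  rw [integral_prod _ (hf.bddMeasurable.mul hgp).integrable]
  simp_rw [integral_mul_const]

lemma integral_mul_right (hf : BoundedKernel f M) {g : ℝ → ℝ} (hg : BddMeasurable g) :
    ∫ p : ℝ × ℝ, f p.1 p.2 * g p.2 ∂ν.prod ν = ∫ u, (∫ v, f u v ∂ν) * g u ∂ν := by
  rw [← hf.integral_mul_left hg, ← integral_prod_swap]
  refine integral_congr_ae (ae_of_all _ fun p => ?_)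
  simp only [Prod.fst_swap, Prod.snd_swap]
  rw [hf.symm]

/-- The variance of the degenerate part, in terms of the moments of the kernel. -/
lemma kernelVar_degeneratePart (hf : BoundedKernel f M) :
    kernelVar ν (degeneratePart ν f) = ∫ p : ℝ × ℝ, f p.1 p.2 ^ 2 ∂ν.prod ν
      - 2 * ∫ u, (∫ v, f u v ∂ν) ^ 2 ∂ν + kernelMean ν f ^ 2 := by
  have hψ := hf.degenerateKernel (ν := ν)
  set ψ := degeneratePart ν f
  set θ := kernelMean ν f
  set g : ℝ → ℝ := fun u => ∫ v, f u v ∂ν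
  have hg : BddMeasurable g := ⟨hf.measurable_integral, M, hf.abs_integral_le⟩
  have hg1 : BddMeasurable fun p : ℝ × ℝ => g p.1 :=
    ⟨hg.measurable.comp measurable_fst, M, fun p => hf.abs_integral_le p.1⟩
  have hg2 : BddMeasurable fun p : ℝ × ℝ => g p.2 :=
    ⟨hg.measurable.comp measurable_snd, M, fun p => hf.abs_integral_le p.2⟩
  have bf := hf.bddMeasurable
  have bψ := hψ.bddMeasurable
  have hsq : kernelVar ν ψ = ∫ p : ℝ × ℝ, ψ p.1 p.2 ^ 2 ∂ν.prod ν :=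
    hψ.boundedKernel_sq.kernelMean_eq
  -- One factor ψ is expanded as f minus its additive part. ψ is orthogonal to functions of a single
  -- variable, so the second bracket integrates to zero and ∫ψ² = ∫fψ.
  have hexp : ∀ p : ℝ × ℝ, ψ p.1 p.2 ^ 2
      = (f p.1 p.2 * f p.1 p.2 - f p.1 p.2 * g p.1 - f p.1 p.2 * g p.2 + θ * f p.1 p.2)
        - (ψ p.1 p.2 * g p.1 + ψ p.1 p.2 * g p.2 - θ * ψ p.1 p.2) := fun p => by
    simp only [ψ, degeneratePart, g, θ]
    ring
  have e1 := hf.integral_mul_left (ν := ν) hg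
  have e2 := hf.integral_mul_right (ν := ν) hg
  have e3 := hψ.integral_mul_left (ν := ν) hg
  have e4 := hψ.integral_mul_right (ν := ν) hg
  have e5 : ∫ p : ℝ × ℝ, ψ p.1 p.2 ∂ν.prod ν = 0 := by
    rw [← hψ.kernelMean_eq, kernelMean]
    simp [hψ.integral_eq_zero]
  simp only [hψ.integral_eq_zero, zero_mul, integral_zero] at e3 e4
  have b1 := bf.mul bf
  have b2 := bf.mul hg1
  have b3 := bf.mul hg2
  have b4 := bf.const_mul θ
  have b5 := bψ.mul hg1
  have b6 := bψ.mul hg2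
  have b7 := bψ.const_mul θ
  rw [hsq]
  simp_rw [hexp]
  rw [integral_sub (((b1.sub b2).sub b3).add b4).integrable ((b5.add b6).sub b7).integrable,
    integral_add ((b1.sub b2).sub b3).integrable b4.integrable,
    integral_sub (b1.sub b2).integrable b3.integrable, integral_sub b1.integrable b2.integrable,
    integral_sub (b5.add b6).integrable b7.integrable, integral_add b5.integrable b6.integrable,
    integral_const_mul, integral_const_mul,
    e1, e2, e3, e4, e5, ← hf.kernelMean_eq]
  simp only [g, θ, sq]
  ring

end BoundedKernel

namespace LipKernel

variable {k : ℝ → ℝ → ℝ} {K M : ℝ}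

/-- With zero mean, some section v ↦ k(F(u), F(v)) would vanish a.e.; positivity off the diagonal
then forces F(v) = F(u) a.e., hence a Dirac mass. -/
lemma kernelMean_pos (hk : LipKernel k K M)
    (h0 : ∀ x ∈ Set.Icc (0 : ℝ) 1, ∀ y ∈ Set.Icc (0 : ℝ) 1, x ≠ y → 0 < k x y)
    (hν : ¬ ∃ c, ∀ᵐ v ∂ν, v = c) : 0 < kernelMean ν (cdfKernel ν k) := by
  have hmem : ∀ v, cdf ν v ∈ Set.Icc (0 : ℝ) 1 := fun v => ⟨cdf_nonneg ν v, cdf_le_one ν v⟩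
  have hf : BoundedKernel (cdfKernel ν k) M := hk.boundedKernel
  have hnn : ∀ u v, 0 ≤ cdfKernel ν k u v := fun u v => by
    by_cases h : cdf ν u = cdf ν v
    · simp [cdfKernel, h, hk.diag]
    · exact (h0 _ (hmem u) _ (hmem v) h).le
  have hg : ∀ u, 0 ≤ ∫ v, cdfKernel ν k u v ∂ν := fun u => integral_nonneg (hnn u)
  refine lt_of_le_of_ne (integral_nonneg hg) fun heq => hν ?_
  have hae := (integral_eq_zero_iff_of_nonneg hg hf.integrable_integral).1 heq.symm
  obtain ⟨u, hu⟩ := hae.exists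
  have hv := (integral_eq_zero_iff_of_nonneg (hnn u) (hf.integrable_section u)).1 hu
  refine exists_ae_eq_of_cdf_ae_eq (q := cdf ν u) (hv.mono fun v h => ?_)
  by_contra hne
  exact (h0 _ (hmem u) _ (hmem v) (Ne.symm hne)).ne' h

/-- With zero variance, k(x, z) = γ(x) + γ(z) - θ at almost all values of the distribution function,
and by continuity also for x = z. There k = 0, so γ = θ/2 a.e.; integrating gives θ = θ/2. -/
lemma kernelVar_pos (hk : LipKernel k K M) (hθ : 0 < kernelMean ν (cdfKernel ν k)) :
    0 < kernelVar ν (degeneratePart ν (cdfKernel ν k)) := by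
  have hF : Measurable fun t => cdf ν t := (monotone_cdf ν).measurable
  have hf : BoundedKernel (cdfKernel ν k) M := hk.boundedKernel
  have hψ := hf.degenerateKernel (ν := ν)
  refine lt_of_le_of_ne (DegenerateKernel.kernelVar_nonneg _) fun heq => ?_
  have hq := hψ.boundedKernel_sq
  have hae := (integral_eq_zero_iff_of_nonneg
    (fun u => integral_nonneg fun v => sq_nonneg _) hq.integrable_integral).1 heq.symm
  have hae2 : ∀ᵐ u ∂ν, ∀ᵐ v ∂ν, degeneratePart ν (cdfKernel ν k) u v = 0 := hae.mono fun u hu =>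
    ((integral_eq_zero_iff_of_nonneg (fun v => sq_nonneg _) (hq.integrable_section u)).1 hu).mono
      fun v hv => pow_eq_zero_iff two_ne_zero |>.1 hv
  -- Taking the projection as a function of the value x = F(u) makes it continuous even when F is
  -- not.
  set γ : ℝ → ℝ := fun x => ∫ v, k x (cdf ν v) ∂ν
  have hki : ∀ x, Integrable (fun v => k x (cdf ν v)) ν := fun x =>
    integrable_of_abs_le (hk.measurable_comp measurable_const hF) fun v => hk.bound _ _
  have hγ : Continuous γ := by
    refine continuous_iff_continuousAt.2 fun x => ?_
    rw [ContinuousAt, tendsto_iff_dist_tendsto_zero]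
    have hlim : Tendsto (fun z : ℝ => K * |z - x|) (𝓝 x) (𝓝 0) := by
      have : Continuous fun z : ℝ => K * |z - x| := by fun_prop
      simpa using this.tendsto x
    refine squeeze_zero (fun _ => dist_nonneg) (fun z => ?_) hlim
    rw [Real.dist_eq, ← integral_sub (hki z) (hki x)]
    refine abs_integral_le fun v => ?_
    simpa using hk.lip z (cdf ν v) x (cdf ν v)
  have hD : Continuous fun p : ℝ × ℝ =>
      k p.1 p.2 - γ p.1 - γ p.2 + kernelMean ν (cdfKernel ν k) :=
    ((hk.continuous.sub (hγ.comp continuous_fst)).sub (hγ.comp continuous_snd)).add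
      continuous_const
  have hdiag := ae_diag_eq_zero (ν := ν)
    (D := fun x z => k x z - γ x - γ z + kernelMean ν (cdfKernel ν k)) hD hF hae2
  have hhalf : ∀ᵐ u ∂ν, ∫ v, cdfKernel ν k u v ∂ν = kernelMean ν (cdfKernel ν k) / 2 := by
    filter_upwards [hdiag] with u hu
    rw [hk.diag] at hu
    change γ (cdf ν u) = _
    linarith
  have hmean := integral_congr_ae hhalf
  rw [integral_const, probReal_univ, one_smul] at hmean
  change kernelMean ν (cdfKernel ν k) = _ at hmean
  linarith

/-- Given the first variable, the two factors of the triple integral are independent with the same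
mean, so it is the integral of the squared projection. -/
lemma asympVar_eq (hk : LipKernel k K M) :
    asympVar k (cdf ν) ν = kernelVar ν (degeneratePart ν (cdfKernel ν k))
      / kernelMean ν (cdfKernel ν k) ^ 2 := by
  have hf : BoundedKernel (cdfKernel ν k) M := hk.boundedKernel
  have htriple : ∫ p : ℝ × ℝ × ℝ, k (cdf ν p.1) (cdf ν p.2.1) * k (cdf ν p.1) (cdf ν p.2.2)
      ∂ν.prod (ν.prod ν) = ∫ u, (∫ v, cdfKernel ν k u v ∂ν) ^ 2 ∂ν := by
    have h1 : BddMeasurable fun p : ℝ × ℝ × ℝ => cdfKernel ν k p.1 p.2.1 :=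
      ⟨hf.measurable_comp measurable_fst (measurable_fst.comp measurable_snd), M,
        fun _ => hf.bound _ _⟩
    have h2 : BddMeasurable fun p : ℝ × ℝ × ℝ => cdfKernel ν k p.1 p.2.2 :=
      ⟨hf.measurable_comp measurable_fst (measurable_snd.comp measurable_snd), M,
        fun _ => hf.bound _ _⟩
    refine (integral_prod _ (h1.mul h2).integrable).trans ?_
    refine integral_congr_ae (ae_of_all _ fun u => ?_)
    simp only
    rw [integral_prod_mul (cdfKernel ν k u) (cdfKernel ν k u), sq]
  rw [asympVar, htriple, hf.kernelVar_degeneratePart, hf.kernelMean_eq]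
  rfl

end LipKernel

end RankCorr

end

/-! ### Independence of the random ordering from the Y-sample. -/

noncomputable section

namespace RankCorr

section Independence

variable {Ω : Type*} [MeasurableSpace Ω] {μ : Measure Ω} [IsProbabilityMeasure μ]

/-- Puts the two members of a pair in the form of a family, so that `iIndepFun_uncurry'` applies to
the array of all pairs. -/
lemma iIndepFun_bool {X : Bool → Ω → ℝ} (hX : ∀ b, Measurable (X b))
    (h : IndepFun (X false) (X true) μ) : iIndepFun X μ := by
  rw [iIndepFun_iff_map_fun_eq_pi_map fun b => (hX b).aemeasurable]
  symm
  have : ∀ b, IsProbabilityMeasure (μ.map (X b)) := fun b =>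
    Measure.isProbabilityMeasure_map (hX b).aemeasurable
  refine Measure.pi_eq fun s hs => ?_
  rw [Measure.map_apply (measurable_pi_lambda _ hX) (MeasurableSet.univ_pi hs), Fintype.prod_bool,
    Measure.map_apply (hX _) (hs _), Measure.map_apply (hX _) (hs _), mul_comm,
    ← h.measure_inter_preimage_eq_mul _ _ (hs false) (hs true)]
  congr 1
  ext ω
  simp

/-- If the pairs are independent of each other, and the two members of each pair are independent,
then the vector of first members is independent of the vector of second members. -/
lemma indepFun_vectors {n : ℕ} {X Y : Fin n → Ω → ℝ} (hX : ∀ i, Measurable (X i))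
    (hY : ∀ i, Measurable (Y i)) (hind : iIndepFun (fun i ω => (X i ω, Y i ω)) μ)
    (hXY : ∀ i, IndepFun (X i) (Y i) μ) :
    IndepFun (fun ω i => X i ω) (fun ω i => Y i ω) μ := by
  -- Independence between rows and within rows makes all 2n variables jointly independent, and the
  -- two columns use disjoint sets of indices.
  set Z : Fin n → Bool → Ω → ℝ := fun i b ω => if b then Y i ω else X i ω
  have hZ : ∀ i b, Measurable (Z i b) := fun i b => by cases b <;> simp [Z, hX, hY]
  have h1 : iIndepFun (fun i ω => (Z i · ω)) μ :=
    hind.comp (fun _ (p : ℝ × ℝ) (b : Bool) => if b then p.2 else p.1) fun _ =>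
      measurable_pi_lambda _ fun b => by
        cases b
        · simpa using measurable_fst
        · simpa using measurable_snd
  have h2 : ∀ i, iIndepFun (Z i) μ := fun i => iIndepFun_bool (hZ i) (by simpa [Z] using hXY i)
  have h3 := iIndepFun_uncurry' hZ h1 h2
  set S : Finset (Fin n × Bool) := Finset.univ.filter fun p => p.2 = false
  set T : Finset (Fin n × Bool) := Finset.univ.filter fun p => p.2 = true
  have hST : Disjoint S T := Finset.disjoint_filter.2 fun p _ hp => by simp [hp]
  have h4 := h3.indepFun_finset S T hST fun p => hZ p.1 p.2
  have h5 := h4.comp (φ := fun (f : S → ℝ) (i : Fin n) => f ⟨(i, false), by simp [S]⟩)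
    (ψ := fun (f : T → ℝ) (i : Fin n) => f ⟨(i, true), by simp [T]⟩) (by fun_prop) (by fun_prop)
  exact h5

lemma measurableSet_mem_sortingPerms {n : ℕ} (σ : Equiv.Perm (Fin n)) :
    MeasurableSet {x : Fin n → ℝ | σ ∈ sortingPerms x} := by
  have : {x : Fin n → ℝ | σ ∈ sortingPerms x}
      = ⋂ i, ⋂ j, {x : Fin n → ℝ | i ≤ j → x (σ i) ≤ x (σ j)} := by
    ext x
    simp only [sortingPerms, Finset.mem_filter, Finset.mem_univ, true_and, Set.mem_iInter,
      Set.mem_ofPred_eq]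
    rfl
  rw [this]
  refine MeasurableSet.iInter fun i => MeasurableSet.iInter fun j => ?_
  by_cases hij : i ≤ j
  · simp only [hij, true_imp_iff]
    exact measurableSet_le (measurable_pi_apply _) (measurable_pi_apply _)
  · simp [hij]

open Classical in
/-- The conditional probability of an ordering given the sample. -/
def orderingProb {n : ℕ} (σ : Equiv.Perm (Fin n)) (x : Fin n → ℝ) : ℝ :=
  if σ ∈ sortingPerms x then 1 / ((sortingPerms x).card : ℝ) else 0

lemma measurable_orderingProb {n : ℕ} (σ : Equiv.Perm (Fin n)) :
    Measurable (orderingProb σ) := by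
  classical
  have hcard : Measurable fun x : Fin n → ℝ => ((sortingPerms x).card : ℝ) := by
    have : (fun x : Fin n → ℝ => ((sortingPerms x).card : ℝ))
        = fun x => ∑ ρ : Equiv.Perm (Fin n), if ρ ∈ sortingPerms x then (1 : ℝ) else 0 := by
      ext x
      rw [Finset.sum_boole]
      simp
    rw [this]
    exact Finset.measurable_fun_sum _ fun ρ _ =>
      Measurable.ite (measurableSet_mem_sortingPerms ρ) measurable_const measurable_const
  exact Measurable.ite (measurableSet_mem_sortingPerms σ) (measurable_const.div hcard)
    measurable_const

/-- A random ordering by `x` is independent of `y` if `x` is independent of `y`. -/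
lemma IsUniformOrdering.measure_inter_eq {n : ℕ} {X Y : Fin n → Ω → ℝ}
    {τ : Ω → Equiv.Perm (Fin n)} (hτ : IsUniformOrdering μ X Y τ) (hX : ∀ i, Measurable (X i))
    (hY : ∀ i, Measurable (Y i)) (hXY : IndepFun (fun ω i => X i ω) (fun ω i => Y i ω) μ)
    (σ : Equiv.Perm (Fin n)) {B : Set (Fin n → ℝ)} (hB : MeasurableSet B) :
    μ ({ω | τ ω = σ} ∩ {ω | (fun i => Y i ω) ∈ B})
      = μ {ω | τ ω = σ} * μ {ω | (fun i => Y i ω) ∈ B} := by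
  have hXm : Measurable fun ω i => X i ω := measurable_pi_lambda _ hX
  have hYm : Measurable fun ω i => Y i ω := measurable_pi_lambda _ hY
  have hpm : Measurable fun ω (i : Fin n) => (X i ω, Y i ω) :=
    measurable_pi_lambda _ fun i => (hX i).prodMk (hY i)
  -- The event on Y belongs to the σ-algebra of the sample, so the conditional probability of the
  -- ordering may be integrated over it; that probability depends on X only, and the integral
  -- factors.
  have key : ∀ B : Set (Fin n → ℝ), MeasurableSet B →
      μ.real ({ω | τ ω = σ} ∩ {ω | (fun i => Y i ω) ∈ B})
        = μ.real {ω | (fun i => Y i ω) ∈ B} * ∫ ω, orderingProb σ (fun i => X i ω) ∂μ := by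
    intro B hB
    have hBm : MeasurableSet[MeasurableSpace.comap
        (fun ω (i : Fin n) => (X i ω, Y i ω)) inferInstance] {ω | (fun i => Y i ω) ∈ B} :=
      ⟨{p | (fun i => (p i).2) ∈ B}, (measurable_pi_lambda _ fun i =>
        measurable_snd.comp (measurable_pi_apply i)) hB, rfl⟩
    have hBm' : MeasurableSet {ω | (fun i => Y i ω) ∈ B} := hYm hB
    have h1 := setIntegral_condExp hpm.comap_le (μ := μ)
      (f := Set.indicator {ω | τ ω = σ} fun _ => (1 : ℝ))
      ((integrable_const 1).indicator (hτ.measurable σ)) hBm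
    rw [integral_indicator (hτ.measurable σ), setIntegral_const, smul_eq_mul, mul_one,
      measureReal_restrict_apply (hτ.measurable σ)] at h1
    rw [← h1, setIntegral_congr_ae (g := fun ω => orderingProb σ (fun i => X i ω)) hBm'
      ((hτ.uniform σ).mono fun ω hω _ => hω), ← integral_indicator hBm']
    have h2 := (hXY.symm.comp (φ := B.indicator fun _ => (1 : ℝ)) (ψ := orderingProb σ)
      (measurable_const.indicator hB) (measurable_orderingProb σ)).integral_fun_mul_eq_mul_integral
      ((measurable_const.indicator hB).comp hYm).aestronglyMeasurable
      ((measurable_orderingProb σ).comp hXm).aestronglyMeasurable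
    have h3 : ∫ ω, ((B.indicator fun _ => (1 : ℝ)) ∘ fun ω i => Y i ω) ω ∂μ
        = μ.real {ω | (fun i => Y i ω) ∈ B} := by
      rw [← integral_indicator_one hBm']
      rfl
    rw [h3] at h2
    refine Eq.trans (integral_congr_ae (ae_of_all _ fun ω => ?_)) h2
    by_cases hω : (fun i => Y i ω) ∈ B <;> simp [hω]
  -- The whole space identifies the remaining integral as the probability of {τ = σ}.
  have hone := key Set.univ MeasurableSet.univ
  simp only [Set.mem_univ, Set.ofPred_true, Set.inter_univ, probReal_univ, one_mul] at hone
  have h := key B hB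
  rw [← hone, mul_comm] at h
  rw [← ENNReal.toReal_eq_toReal_iff' (measure_ne_top _ _)
    (ENNReal.mul_ne_top (measure_ne_top _ _) (measure_ne_top _ _)), ENNReal.toReal_mul]
  exact h

/-- The law of a statistic of a randomly reordered i.i.d. sample, if the ordering is independent
of the sample. -/
lemma map_reordered_eq {ν : Measure ℝ} [IsProbabilityMeasure ν] {Ys : ℕ → Ω → ℝ}
    (hYs : ∀ i, Measurable (Ys i)) (hlaw : μ.map (fun ω i => Ys i ω) = iidLaw ν) {n : ℕ}
    {τ : Ω → Equiv.Perm (Fin n)} (hτ : ∀ σ, MeasurableSet {ω | τ ω = σ})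
    (hind : ∀ (σ : Equiv.Perm (Fin n)) {B : Set (Fin n → ℝ)}, MeasurableSet B →
      μ ({ω | τ ω = σ} ∩ {ω | (fun i : Fin n => Ys i ω) ∈ B})
        = μ {ω | τ ω = σ} * μ {ω | (fun i : Fin n => Ys i ω) ∈ B})
    {G : (Fin n → ℝ) → ℝ} (hG : Measurable G) :
    Measurable (fun ω => G fun i => Ys (τ ω i) ω) ∧
    μ.map (fun ω => G fun i => Ys (τ ω i) ω)
      = (iidLaw ν).map fun y => G fun i : Fin n => y i := by
  have hYm : Measurable fun ω i => Ys i ω := measurable_pi_lambda _ hYs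
  have hGσ : ∀ σ : Equiv.Perm (Fin n), Measurable fun v : Fin n → ℝ => G fun i => v (σ i) :=
    fun σ => hG.comp (measurable_pi_lambda _ fun i => measurable_pi_apply _)
  have hpre : ∀ C : Set ℝ, (fun ω => G fun i => Ys (τ ω i) ω) ⁻¹' C
      = ⋃ σ : Equiv.Perm (Fin n), {ω | τ ω = σ} ∩
        {ω | (fun i : Fin n => Ys i ω) ∈ (fun v : Fin n → ℝ => G fun i => v (σ i)) ⁻¹' C} := by
    intro C
    ext ω
    simp
  have hms : ∀ {C : Set ℝ}, MeasurableSet C → ∀ σ : Equiv.Perm (Fin n), MeasurableSet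
      ({ω | τ ω = σ} ∩
        {ω | (fun i : Fin n => Ys i ω) ∈ (fun v : Fin n → ℝ => G fun i => v (σ i)) ⁻¹' C}) :=
    fun hC σ => (hτ σ).inter ((measurable_pi_lambda (fun ω (i : Fin n) => Ys i ω)
      fun i => hYs i) (hGσ σ hC))
  have hmeas : Measurable fun ω => G fun i => Ys (τ ω i) ω := fun C hC => by
    rw [hpre C]
    exact MeasurableSet.iUnion fun σ => hms hC σ
  refine ⟨hmeas, ?_⟩
  -- The law of the reordered vector does not depend on σ, so it factors out of the sum over the
  -- values of τ, whose probabilities add up to 1.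
  have hvec : ∀ σ : Equiv.Perm (Fin n), (iidLaw ν).map (fun y (i : Fin n) => y (σ i))
      = Measure.infinitePi fun _ : Fin n => ν := fun σ =>
    Measure.map_infinitePi_infinitePi_of_inj (P := fun _ : ℕ => ν)
      (f := fun i : Fin n => ((σ i : Fin n) : ℕ)) (Fin.val_injective.comp σ.injective)
  have hGm : Measurable fun y : ℕ → ℝ => G fun i : Fin n => y i :=
    hG.comp (measurable_pi_lambda (fun (y : ℕ → ℝ) (i : Fin n) => y i)
      fun i => measurable_pi_apply _)
  ext C hC
  have hone : ∀ σ : Equiv.Perm (Fin n),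
      μ {ω | (fun i : Fin n => Ys i ω) ∈ (fun v : Fin n → ℝ => G fun i => v (σ i)) ⁻¹' C}
        = (iidLaw ν).map (fun y => G fun i : Fin n => y i) C := by
    intro σ
    have hσm : Measurable fun (y : ℕ → ℝ) (i : Fin n) => y (σ i) :=
      measurable_pi_lambda _ fun i => measurable_pi_apply _
    have hidm : Measurable fun (y : ℕ → ℝ) (i : Fin n) => y ((1 : Equiv.Perm (Fin n)) i) :=
      measurable_pi_lambda _ fun i => measurable_pi_apply _
    have h1 : (iidLaw ν).map (fun y (i : Fin n) => y (σ i)) (G ⁻¹' C)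
        = (iidLaw ν).map (fun y (i : Fin n) => y ((1 : Equiv.Perm (Fin n)) i)) (G ⁻¹' C) := by
      rw [hvec, hvec]
    rw [Measure.map_apply hσm (hG hC), Measure.map_apply hidm (hG hC)] at h1
    rw [Measure.map_apply hGm hC]
    refine Eq.trans ?_ h1
    rw [← hlaw, Measure.map_apply hYm (hσm (hG hC))]
    rfl
  rw [Measure.map_apply hmeas hC, hpre C, measure_iUnion _ (hms hC)]
  · rw [tsum_congr fun σ => (hind σ (hGσ σ hC)).trans (congrArg _ (hone σ)),
      ENNReal.tsum_mul_right]
    have htot : ∑' σ : Equiv.Perm (Fin n), μ {ω | τ ω = σ} = 1 := by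
      rw [← measure_iUnion _ hτ]
      · have : ⋃ σ : Equiv.Perm (Fin n), {ω | τ ω = σ} = Set.univ := by
          ext ω
          simp
        rw [this, measure_univ]
      · intro σ ρ hne
        exact Set.disjoint_left.2 fun ω h1 h2 => hne (h1.symm.trans h2)
    rw [htot, one_mul]
  · intro σ ρ hne
    exact Set.disjoint_left.2 fun ω h1 h2 => hne (h1.1.symm.trans h2.1)

end Independence

/-! ### Extension of the kernel to the plane; from finite samples to sequences. -/

/-- The clamping of the real line to the unit interval. -/
def clamp (x : ℝ) : ℝ := max 0 (min 1 x)

lemma clamp_mem (x : ℝ) : clamp x ∈ Set.Icc (0 : ℝ) 1 :=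
  ⟨le_max_left _ _, max_le zero_le_one (min_le_left _ _)⟩

lemma clamp_of_mem {x : ℝ} (hx : x ∈ Set.Icc (0 : ℝ) 1) : clamp x = x := by
  rw [clamp, min_eq_right hx.2, max_eq_right hx.1]

lemma abs_clamp_sub_le (x y : ℝ) : |clamp x - clamp y| ≤ |x - y| := by
  refine (abs_max_sub_max_le_max _ _ _ _).trans ?_
  rw [sub_self, abs_zero]
  refine max_le (abs_nonneg _) ((abs_min_sub_min_le_max _ _ _ _).trans ?_)
  simp

/-- The extension of a kernel on the unit square to the plane. -/
def clampKernel (h : ℝ → ℝ → ℝ) (u v : ℝ) : ℝ := h (clamp u) (clamp v)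

lemma clampKernel_of_mem (h : ℝ → ℝ → ℝ) {u v : ℝ} (hu : u ∈ Set.Icc (0 : ℝ) 1)
    (hv : v ∈ Set.Icc (0 : ℝ) 1) : clampKernel h u v = h u v := by
  rw [clampKernel, clamp_of_mem hu, clamp_of_mem hv]

/-- Clamping is 1-Lipschitz. The same K bounds the kernel, since |h(u, v)| = |h(u, v) - h(u, u)| ≤
K|v - u| ≤ K on the unit square. -/
lemma RegularKernel.exists_lipKernel {h : ℝ → ℝ → ℝ} (hreg : RegularKernel h)
    (hlip : LipschitzKernel h) : ∃ K, LipKernel (clampKernel h) K K := by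
  obtain ⟨K, hK, hl⟩ := hlip
  refine ⟨K, fun u v u' v' => ?_, fun u v => hreg.symm _ (clamp_mem u) _ (clamp_mem v),
    fun u => hreg.diag _ (clamp_mem u), fun u v => ?_⟩
  · refine (hl _ (clamp_mem u) _ (clamp_mem v) _ (clamp_mem u') _ (clamp_mem v')).trans ?_
    have := abs_clamp_sub_le u u'
    have := abs_clamp_sub_le v v'
    gcongr
  · have h1 := hl _ (clamp_mem u) _ (clamp_mem v) _ (clamp_mem u) _ (clamp_mem u)
    rw [hreg.diag _ (clamp_mem u), sub_zero, sub_self, abs_zero, zero_add] at h1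
    refine h1.trans (mul_le_of_le_one_right hK.le (abs_le.2 ?_))
    have hu := clamp_mem u
    have hv := clamp_mem v
    constructor <;> linarith [hu.1, hu.2, hv.1, hv.2]

lemma asympVar_clampKernel (h : ℝ → ℝ → ℝ) {F : ℝ → ℝ} (hF : ∀ t, F t ∈ Set.Icc (0 : ℝ) 1)
    (ν : Measure ℝ) : asympVar (clampKernel h) F ν = asympVar h F ν := by
  simp only [asympVar, clampKernel, clamp_of_mem (hF _)]

lemma empCdf_mem (n : ℕ) (y : ℕ → ℝ) (t : ℝ) : empCdf n y t ∈ Set.Icc (0 : ℝ) 1 := by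
  refine ⟨div_nonneg (Finset.sum_nonneg fun j _ => by split_ifs <;> norm_num)
    (Nat.cast_nonneg n), div_le_one_of_le₀ ?_ (Nat.cast_nonneg n)⟩
  refine (Finset.sum_le_sum (g := fun _ => (1 : ℝ)) fun j _ => ?_).trans (by simp)
  split_ifs <;> norm_num

/-- The rank-based coefficient of a reordered finite sample is that of the reordered sequence. -/
lemma rankCoeff_eq_seqCoeff (h : ℝ → ℝ → ℝ) {n : ℕ} (v : Fin n → ℝ) (τ : Equiv.Perm (Fin n))
    {z : ℕ → ℝ} (hz : ∀ i : Fin n, z i = v (τ i)) :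
    rankCoeff h v τ = seqCoeff (clampKernel h) n z := by
  -- Ranks and normalization are symmetric in the sample; only the variation statistic sees the
  -- order.
  have hrank : ∀ t, rank v t / n = empCdf n z t := fun t => by
    rw [rank, empCdf, Finset.sum_range, ← Equiv.sum_comp τ]
    simp_rw [hz]
  have hnorm : normalizationStat h v = seqNormalization (clampKernel h) n z := by
    rw [normalizationStat, seqNormalization, Finset.sum_range, ← Equiv.sum_comp τ]
    congr 1
    refine Finset.sum_congr rfl fun i _ => ?_
    rw [Finset.sum_range, ← Equiv.sum_comp τ]
    refine Finset.sum_congr rfl fun j _ => ?_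
    rw [rankKernel, clampKernel_of_mem h (empCdf_mem _ _ _) (empCdf_mem _ _ _), hrank, hrank, hz,
      hz]
  have hvar : variationStat h v τ = seqVariation (clampKernel h) n z := by
    rw [variationStat, seqVariation, Finset.sum_range]
    congr 1
    refine Finset.sum_congr rfl fun i _ => ?_
    rw [rankKernel, clampKernel_of_mem h (empCdf_mem _ _ _) (empCdf_mem _ _ _), hrank, hrank,
      ← hz, ← hz]
  rw [rankCoeff, seqCoeff, hnorm, hvar]

/-- Extension of a finite sample by zeros. -/
def extendZero {n : ℕ} (v : Fin n → ℝ) (i : ℕ) : ℝ := if hi : i < n then v ⟨i, hi⟩ else 0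

lemma measurable_extendZero (n : ℕ) : Measurable (extendZero : (Fin n → ℝ) → ℕ → ℝ) := by
  refine measurable_pi_lambda _ fun i => ?_
  unfold extendZero
  split_ifs
  · exact measurable_pi_apply _
  · exact measurable_const

lemma extendZero_apply {n : ℕ} (v : Fin n → ℝ) (i : Fin n) : extendZero v i = v i := by
  simp [extendZero]

end RankCorr

end

/-! ### The limit theorem for the randomly ordered sample. -/

theorem theorem6 {Ω : Type*} [MeasurableSpace Ω] (μ : Measure Ω) [IsProbabilityMeasure μ]
    (h : ℝ → ℝ → ℝ) (hreg : RankCorr.RegularKernel h) (hlip : RankCorr.LipschitzKernel h)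
    -- the pair `(X, Y)`
    (X Y : Ω → ℝ) (hX : Measurable X) (hY : Measurable Y)
    (hXc : ¬ ∃ c : ℝ, X =ᵐ[μ] fun _ => c) (hYc : ¬ ∃ c : ℝ, Y =ᵐ[μ] fun _ => c)
    (hXY : IndepFun X Y μ)
    -- the i.i.d. copies of `(X, Y)`
    (Xs Ys : ℕ → Ω → ℝ) (hXs : ∀ i, Measurable (Xs i)) (hYs : ∀ i, Measurable (Ys i))
    (hindep : iIndepFun (fun i ω => (Xs i ω, Ys i ω)) μ)
    (hident : ∀ i, IdentDistrib (fun ω => (Xs i ω, Ys i ω)) (fun ω => (X ω, Y ω)) μ μ)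
    -- the ordering of the first `n` of them by increasing `X`
    (τ : (n : ℕ) → Ω → Equiv.Perm (Fin n))
    (hτ : ∀ n, RankCorr.IsUniformOrdering μ (fun i : Fin n => Xs i) (fun i : Fin n => Ys i) (τ n)) :
    0 < RankCorr.asympVar h (cdf (μ.map Y)) (μ.map Y) ∧
    TendstoInDistribution
      (fun (n : ℕ) ω => √(n : ℝ) * RankCorr.rankCoeff h (fun i : Fin n => Ys i ω) (τ n ω))
      atTop (fun z : ℝ => z) (fun _ => μ)
      (gaussianReal 0 (RankCorr.asympVar h (cdf (μ.map Y)) (μ.map Y)).toNNReal) := by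
  open RankCorr in
  have hprob : IsProbabilityMeasure (μ.map Y) := Measure.isProbabilityMeasure_map hY.aemeasurable
  obtain ⟨K, hk⟩ := hreg.exists_lipKernel hlip
  have hν : ¬ ∃ c, ∀ᵐ v ∂μ.map Y, v = c := fun ⟨c, hc⟩ =>
    hYc ⟨c, ae_of_ae_map hY.aemeasurable hc⟩
  have hθ : 0 < kernelMean (μ.map Y) (cdfKernel (μ.map Y) (clampKernel h)) :=
    hk.kernelMean_pos (fun x hx y hy hne => by
      rw [clampKernel_of_mem h hx hy]; exact hreg.pos x hx y hy hne) hν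
  have hs2 := hk.kernelVar_pos hθ
  have hasymp : asympVar h (cdf (μ.map Y)) (μ.map Y) = _ :=
    (asympVar_clampKernel h (fun t => ⟨cdf_nonneg _ t, cdf_le_one _ t⟩) _).symm.trans hk.asympVar_eq
  rw [hasymp]
  refine ⟨by positivity, ?_⟩
  have hlawY : ∀ i, μ.map (Ys i) = μ.map Y := fun i =>
    ((hident i).comp measurable_snd).map_eq
  have hlawX : ∀ i, μ.map (Xs i) = μ.map X := fun i =>
    ((hident i).comp measurable_fst).map_eq
  have hXYi : ∀ i, IndepFun (Xs i) (Ys i) μ := fun i => by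
    rw [indepFun_iff_map_prod_eq_prod_map_map (hXs i).aemeasurable (hYs i).aemeasurable,
      (hident i).map_eq, hlawX, hlawY]
    exact hXY.map_prod_eq_prod_map_map hX.aemeasurable hY.aemeasurable
  have hindY : iIndepFun Ys μ := hindep.comp (fun _ p => p.2) fun _ => measurable_snd
  have hlaw : μ.map (fun ω i => Ys i ω) = iidLaw (μ.map Y) := by
    rw [hindY.map_fun_eq_infinitePi_map hYs]
    simp_rw [hlawY]
  have hS := hk.tendstoInDistribution_seqCoeff hθ
  -- Equality of laws for each n suffices, as convergence in distribution involves only the marginal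
  -- laws.
  have hmap : ∀ n : ℕ,
      Measurable (fun ω => √(n : ℝ) * rankCoeff h (fun i : Fin n => Ys i ω) (τ n ω)) ∧
      μ.map (fun ω => √(n : ℝ) * rankCoeff h (fun i : Fin n => Ys i ω) (τ n ω))
        = (iidLaw (μ.map Y)).map fun y => √(n : ℝ) * seqCoeff (clampKernel h) n y := by
    intro n
    have hvec : IndepFun (fun ω (i : Fin n) => Xs i ω) (fun ω (i : Fin n) => Ys i ω) μ :=
      indepFun_vectors (fun i => hXs i) (fun i => hYs i) (hindep.precomp Fin.val_injective)
        fun i => hXYi i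
    have hG : Measurable fun v : Fin n → ℝ =>
        √(n : ℝ) * seqCoeff (clampKernel h) n (extendZero v) :=
      ((hk.measurable_seqCoeff n).comp (measurable_extendZero n)).const_mul _
    have hr := map_reordered_eq hYs hlaw (hτ n).measurable
      (fun σ {B} hB => (hτ n).measure_inter_eq (fun i => hXs i) (fun i => hYs i) hvec σ hB) hG
    have e1 : ∀ ω, rankCoeff h (fun i : Fin n => Ys i ω) (τ n ω)
        = seqCoeff (clampKernel h) n (extendZero fun i => Ys (τ n ω i) ω) := fun ω =>
      rankCoeff_eq_seqCoeff h _ _ fun i => extendZero_apply _ i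
    -- The coefficient reads only the first n terms, as its expression through `rankCoeff` with the
    -- identity ordering shows.
    have e2 : ∀ y : ℕ → ℝ, seqCoeff (clampKernel h) n (extendZero fun i : Fin n => y i)
        = seqCoeff (clampKernel h) n y := fun y =>
      (rankCoeff_eq_seqCoeff h (fun i : Fin n => y i) 1 fun i => extendZero_apply _ i).symm.trans
        (rankCoeff_eq_seqCoeff h _ 1 fun i => rfl)
    simp only [e1]
    simp only [e2] at hr
    exact hr
  exact ⟨fun n => (hmap n).1.aemeasurable, aemeasurable_id,
    hS.tendsto.congr fun n => Subtype.ext (hmap n).2.symm⟩
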